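/- **Setting.** Let $\Omega\subset\mathbb R^d$ be a bounded open set (for example a bounded domain with Lipschitz boundary, $d=1,2,3$), and let $\varepsilon,\beta,\kappa,c_v>0$, and $L_\alpha\ge 0$, $T_\alpha>0$ for $\alpha=1,\dots,M$. Put $L=(L_\alpha)_\alpha$, $\widetilde L=(L_\alpha/T_\alpha)_\alpha$, $K=-I\in\mathbb R^{M\times M}$, let $$G=\Bigl\{v\in\mathbb R^M : \sum_{\alpha} v_\alpha=1,\ v_\alpha\ge 0\Bigr\},\qquad \mathcal G=\{v\in H^1(\Omega)^M : v(x)\in G \text{ for a.e. } x\in\Omega\},$$ and let $\chi_{\mathcal G}$ be $0$ on $\mathcal G$ and $+\infty$ elsewhere. The energy density $e$ and the entropy density $s$ are given in terms of the temperature $T$ and the phase field $\phi$ by $$e=-L^T\phi+c_vT,\qquad s(e,\phi)=-\widetilde L^T\phi+c_v\ln T ,$$ and the entropy is the extended-real-valued functional $$S(e,\phi)=\int_\Omega \Bigl(s(e,\phi)-\tfrac{\varepsilon}{2}|\nabla\phi|^2-\tfrac1{2\varepsilon}\phi^TK\phi\Bigr)\,dx-\chi_{\mathcal G}(\phi),$$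 where $\int_\Omega f\,dx$ means $\int_\Omega f^+dx-\int_\Omega f^-dx$. Let $(\cdot,\cdot)$ denote the $L^2(\Omega)$ pairing. **System.** Let $t^*>0$, $\phi^0\in L^2(\Omega)^M$, $\theta^0\in L^2(\Omega)$, $\theta^0\ge0$ a.e. A solution of the multi-phase Penrose–Fife system with obstacle potential, with source $q=0$ and convection coefficient $h_c=0$, is a pair $$\phi\in L^2((0,t^*),H^1(\Omega)^M)\cap H^1((0,t^*),L^2(\Omega)^M),\qquad \theta\in L^2((0,t^*),H^1(\Omega))\cap H^1((0,t^*),L^2(\Omega)),$$ represented by continuous functions $[0,t^*]\to L^2(\Omega)^M$ and $[0,t^*]\to L^2(\Omega)$, with $\theta>0$ a.e. in $(0,t^*)\times\Omega$, $\phi(0)=\phi^0$, $\theta(0)=\theta^0$, such that for a.e. $t\in(0,t^*)$ $$\bigl(\varepsilon\beta\phi_t+\widetilde L-\theta L+\tfrac1\varepsilon K\phi,\;v-\phi\bigr)+\varepsilon(\nabla\phi,\nabla(v-\phi))+\chi_{\mathcal G}(v)-\chi_{\mathcal G}(\phi)\ge 0\qquad\forall v\in H^1(\Omega)^M,$$ $$\bigl(-L^T\phi_t-c_v\tfrac1{\theta^2}\theta_t,\;w\bigr)-(\kappa\nabla\theta,\nabla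 w)=0\qquad\forall w\in H^1(\Omega),$$ where the first relation includes $\phi(t)\in\mathcal G$, and the second includes that $\theta^{-2}\theta_t\,w$ is integrable on $\Omega$ for every $w\in H^1(\Omega)$. **Proposition (thermodynamic consistency).** Let $(\phi,\theta)$ be such a solution, let $0<t_0\le t^*$, and suppose $\phi\in C^1([t_0,t^*],H^1(\Omega)^M)$. Let $e(t)=-L^T\phi(t)+c_v/\theta(t)$ be the corresponding energy density, where $T=1/\theta=+\infty$, $e=+\infty$ and $s=+\infty$ at points with $\theta=0$. Then the entropy $S(e(t),\phi(t))$ is non-decreasing in $t$ on $[t_0,t^*]$: $$S(e(t_1),\phi(t_1))\le S(e(t_2),\phi(t_2))\qquad\text{whenever } t_0\le t_1\le t_2\le t^* .$$ In particular $S(e(t),\phi(t))\ge S(e(t_0),\phi(t_0))$ for all $t\in[t_0,t^*]$. -/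

import Mathlib

open MeasureTheory
open scoped ContDiff ENNReal

noncomputable section

namespace PenroseFife

/-! ### Lebesgue and Sobolev spaces on `Ω ⊆ ℝ^d` -/

abbrev E (d : ℕ) := EuclideanSpace ℝ (Fin d)

/-- `L²(Ω)`. -/
abbrev L2 {d : ℕ} (Ω : Set (E d)) := Lp ℝ 2 (volume.restrict Ω)

/-- `L²(Ω)^d`, the space in which gradients live. -/
abbrev L2Vec {d : ℕ} (Ω : Set (E d)) := Lp (E d) 2 (volume.restrict Ω)

/-- Test functions: `ζ ∈ C_c^∞(Ω)`. -/
def IsTestFunction {X : Type*} [NormedAddCommGroup X] [NormedSpace ℝ X]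
    (Ω : Set X) (ζ : X → ℝ) : Prop :=
  ContDiff ℝ ∞ ζ ∧ HasCompactSupport ζ ∧ tsupport ζ ⊆ Ω

/-- `g ∈ L²(Ω)^d` is the weak gradient of `u ∈ L²(Ω)`:
`∫_Ω u ∂_i ζ = - ∫_Ω g_i ζ` for all test functions `ζ` and all `i`. -/
def IsWeakGradient {d : ℕ} {Ω : Set (E d)} (u : L2 Ω) (g : L2Vec Ω) : Prop :=
  ∀ ζ : E d → ℝ, IsTestFunction Ω ζ → ∀ i : Fin d,
    ∫ x in Ω, u x * fderiv ℝ ζ x (EuclideanSpace.single i 1) = - ∫ x in Ω, g x i * ζ x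

theorem IsTestFunction.memLp {d : ℕ} {Ω : Set (E d)} {ζ : E d → ℝ} (h : IsTestFunction Ω ζ) :
    MemLp ζ 2 (volume.restrict Ω) :=
  (h.1.continuous.memLp_of_hasCompactSupport h.2.1).restrict Ω

theorem IsTestFunction.memLp_fderiv {d : ℕ} {Ω : Set (E d)} {ζ : E d → ℝ}
    (h : IsTestFunction Ω ζ) (v : E d) :
    MemLp (fun x => fderiv ℝ ζ x v) 2 (volume.restrict Ω) := by
  have hc : Continuous (fun x => fderiv ℝ ζ x v) :=
    (h.1.continuous_fderiv (by simp)).clm_apply continuous_const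
  exact (hc.memLp_of_hasCompactSupport (h.2.1.fderiv_apply ℝ v)).restrict Ω

theorem integrable_mul_fderiv {d : ℕ} {Ω : Set (E d)} (u : L2 Ω) {ζ : E d → ℝ}
    (h : IsTestFunction Ω ζ) (v : E d) :
    Integrable (fun x => u x * fderiv ℝ ζ x v) (volume.restrict Ω) :=
  (Lp.memLp u).integrable_mul (h.memLp_fderiv v)

theorem integrable_coord_mul {d : ℕ} {Ω : Set (E d)} (g : L2Vec Ω) {ζ : E d → ℝ}
    (h : IsTestFunction Ω ζ) (i : Fin d) :
    Integrable (fun x => g x i * ζ x) (volume.restrict Ω) :=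
  ((EuclideanSpace.proj (𝕜 := ℝ) i : E d →L[ℝ] ℝ).comp_memLp' (Lp.memLp g)
    ).integrable_mul h.memLp

theorem IsWeakGradient.zero {d : ℕ} {Ω : Set (E d)} :
    IsWeakGradient (0 : L2 Ω) (0 : L2Vec Ω) := by
  intro ζ _ i
  have h1 : ∫ x in Ω, (0 : L2 Ω) x * fderiv ℝ ζ x (EuclideanSpace.single i 1) = 0 := by
    apply integral_eq_zero_of_ae
    filter_upwards [Lp.coeFn_zero ℝ 2 (volume.restrict Ω)] with x hx
    rw [hx, Pi.zero_apply, zero_mul]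
  have h2 : ∫ x in Ω, (0 : L2Vec Ω) x i * ζ x = 0 := by
    apply integral_eq_zero_of_ae
    filter_upwards [Lp.coeFn_zero (E d) 2 (volume.restrict Ω)] with x hx
    rw [hx, Pi.zero_apply, PiLp.zero_apply, zero_mul]; rfl
  rw [h1, h2, neg_zero]

theorem IsWeakGradient.add {d : ℕ} {Ω : Set (E d)} {u v : L2 Ω} {g k : L2Vec Ω}
    (hu : IsWeakGradient u g) (hv : IsWeakGradient v k) : IsWeakGradient (u + v) (g + k) := by
  intro ζ h i
  have h1 : ∫ x in Ω, (u + v) x * fderiv ℝ ζ x (EuclideanSpace.single i 1) =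
      ∫ x in Ω, (u x * fderiv ℝ ζ x (EuclideanSpace.single i 1) +
        v x * fderiv ℝ ζ x (EuclideanSpace.single i 1)) := by
    apply integral_congr_ae
    filter_upwards [Lp.coeFn_add u v] with x hx
    rw [hx, Pi.add_apply, add_mul]
  have h2 : ∫ x in Ω, (g + k) x i * ζ x = ∫ x in Ω, (g x i * ζ x + k x i * ζ x) := by
    apply integral_congr_ae
    filter_upwards [Lp.coeFn_add g k] with x hx
    rw [hx, Pi.add_apply, PiLp.add_apply, add_mul]
  rw [h1, h2, integral_add (integrable_mul_fderiv u h _) (integrable_mul_fderiv v h _),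
    integral_add (integrable_coord_mul g h i) (integrable_coord_mul k h i), hu ζ h i, hv ζ h i,
    neg_add]

theorem IsWeakGradient.smul {d : ℕ} {Ω : Set (E d)} {u : L2 Ω} {g : L2Vec Ω} (c : ℝ)
    (hu : IsWeakGradient u g) : IsWeakGradient (c • u) (c • g) := by
  intro ζ h i
  have h1 : ∫ x in Ω, (c • u) x * fderiv ℝ ζ x (EuclideanSpace.single i 1) =
      ∫ x in Ω, c * (u x * fderiv ℝ ζ x (EuclideanSpace.single i 1)) := by
    apply integral_congr_ae
    filter_upwards [Lp.coeFn_smul c u] with x hx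
    rw [hx, Pi.smul_apply, smul_eq_mul, mul_assoc]
  have h2 : ∫ x in Ω, (c • g) x i * ζ x = ∫ x in Ω, c * (g x i * ζ x) := by
    apply integral_congr_ae
    filter_upwards [Lp.coeFn_smul c g] with x hx
    rw [hx, Pi.smul_apply, PiLp.smul_apply, smul_eq_mul, mul_assoc]
  rw [h1, h2, integral_const_mul, integral_const_mul, hu ζ h i, mul_neg]

/-- `H¹(Ω)`, realised as the space of pairs `(u, ∇u) ∈ L²(Ω) × L²(Ω)^d` with the norm
`(‖u‖² + ‖∇u‖²)^{1/2}`. -/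
def H1 {d : ℕ} (Ω : Set (E d)) : Submodule ℝ (WithLp 2 (L2 Ω × L2Vec Ω)) where
  carrier := {p | IsWeakGradient p.fst p.snd}
  zero_mem' := IsWeakGradient.zero
  add_mem' hp hq := IsWeakGradient.add hp hq
  smul_mem' c _ hp := IsWeakGradient.smul c hp

/-- The function underlying an element of `H¹(Ω)`. -/
def toL2 {d : ℕ} {Ω : Set (E d)} (u : H1 Ω) : L2 Ω := u.1.fst

/-- The (weak) gradient of an element of `H¹(Ω)`. -/
def grad {d : ℕ} {Ω : Set (E d)} (u : H1 Ω) : L2Vec Ω := u.1.snd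

/-! ### Spaces of functions of time -/

/-- `u ∈ H¹((0,T), X)` with weak time derivative `u'`; `u` is the representative
that is continuous on `[0,T]`, so that the values `u t` are meaningful. -/
def IsTimeSobolev {X : Type*} [NormedAddCommGroup X] [NormedSpace ℝ X]
    (T : ℝ) (u u' : ℝ → X) : Prop :=
  ContinuousOn u (Set.Icc 0 T) ∧
  MemLp u 2 (volume.restrict (Set.Ioo 0 T)) ∧
  MemLp u' 2 (volume.restrict (Set.Ioo 0 T)) ∧
  ∀ ζ : ℝ → ℝ, IsTestFunction (Set.Ioo 0 T) ζ →
    ∫ t in Set.Ioo 0 T, deriv ζ t • u t = - ∫ t in Set.Ioo 0 T, ζ t • u' t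

/-! ### The model -/

/-- The material parameters of the model with `M` phases: interface width `ε`, kinetic coefficient
`β`, mobility `κ`, specific heat capacity `c_v`, latent heats `L_α`, melting temperatures `T_α`. -/
structure Parameters (M : ℕ) where
  ε : ℝ
  β : ℝ
  κ : ℝ
  cv : ℝ
  L : Fin M → ℝ
  Tm : Fin M → ℝ
  ε_pos : 0 < ε
  β_pos : 0 < β
  κ_pos : 0 < κ
  cv_pos : 0 < cv
  L_nonneg : ∀ α, 0 ≤ L α
  Tm_pos : ∀ α, 0 < Tm α

/-- `L̃_α = L_α / T_α`. -/
def Parameters.Ltilde {M : ℕ} (P : Parameters M) (α : Fin M) : ℝ := P.L α / P.Tm α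

/-- The interaction matrix `K = -I`. -/
def K (M : ℕ) : Matrix (Fin M) (Fin M) ℝ := -1

/-- The temperature `T = 1/θ` as an extended number (`T = ∞` where `θ = 0`). -/
def temperature (θ : ℝ) : ℝ≥0∞ := (ENNReal.ofReal θ)⁻¹

/-- The internal energy density `e = ẽ(T,φ) = - ∑ L_α φ_α + c_v T`. -/
def energy {M : ℕ} (P : Parameters M) (T : ℝ≥0∞) (φ : Fin M → ℝ) : EReal :=
  ((- ∑ α, P.L α * φ α : ℝ) : EReal) + (P.cv : EReal) * (T : EReal)

/-- The entropy density `s(e,φ) = - ∑ (L_α/T_α) φ_α + c_v ln T`, where `T` is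
the temperature determined by `e = - ∑ L_α φ_α + c_v T`. -/
def entropyDensity {M : ℕ} (P : Parameters M) (e : EReal) (φ : Fin M → ℝ) : EReal :=
  ((- ∑ α, P.Ltilde α * φ α : ℝ) : EReal) +
    (P.cv : EReal) *
      ENNReal.log ((e + ((∑ α, P.L α * φ α : ℝ) : EReal)) / (P.cv : EReal)).toENNReal

/-- The integral `∫ f⁺ - ∫ f⁻` of an extended real valued function. -/
def extIntegral {X : Type*} [MeasurableSpace X] (μ : Measure X) (f : X → EReal) : EReal :=
  ((∫⁻ x, (f x).toENNReal ∂μ : ℝ≥0∞) : EReal) - ((∫⁻ x, (- f x).toENNReal ∂μ : ℝ≥0∞) : EReal)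

/-- `𝒢`: phase fields in `H¹(Ω)^M` with values a.e. in the Gibbs simplex. -/
def gibbsSet {d : ℕ} (Ω : Set (E d)) (M : ℕ) : Set (Fin M → H1 Ω) :=
  {v | ∀ᵐ x ∂(volume.restrict Ω), (fun α => toL2 (v α) x) ∈ stdSimplex ℝ (Fin M)}

open Classical in
/-- The characteristic functional `χ_A`, equal to `0` on `A` and to `+∞` off `A`. -/
def chi {X : Type*} (A : Set X) (x : X) : EReal := if x ∈ A then 0 else ⊤

/-- `S₀(e,φ) = ∫_Ω s(e,φ) - (ε/2) |∇φ|² - (1/(2ε)) φᵀKφ dx`. -/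
def entropy₀ {d M : ℕ} {Ω : Set (E d)} (P : Parameters M) (e : E d → EReal)
    (φ : Fin M → H1 Ω) : EReal :=
  extIntegral (volume.restrict Ω) fun x =>
    entropyDensity P (e x) (fun α => toL2 (φ α) x)
      - ((P.ε / 2 * ∑ α, ‖grad (φ α) x‖ ^ 2
          + 1 / (2 * P.ε) *
            ((fun α => toL2 (φ α) x) ⬝ᵥ (K M).mulVec (fun α => toL2 (φ α) x)) : ℝ) : EReal)

/-- The entropy functional `S(e,φ) = S₀(e,φ) - χ_𝒢(φ)`. -/
def entropy {d M : ℕ} {Ω : Set (E d)} (P : Parameters M) (e : E d → EReal)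
    (φ : Fin M → H1 Ω) : EReal :=
  entropy₀ P e φ - chi (gibbsSet Ω M) φ

/-- The internal energy density `e` belonging to inverse temperature `θ` and phase field `φ`. -/
def energyField {d M : ℕ} {Ω : Set (E d)} (P : Parameters M) (θ : L2 Ω)
    (φ : Fin M → L2 Ω) (x : E d) : EReal :=
  energy P (temperature (θ x)) (fun α => φ α x)

/-- `(φ, θ)` solves the multi-phase Penrose–Fife system with obstacle potential on `(0,T)`,
with source `q = 0` and convection coefficient `h_c = 0`, and with initial values `φ⁰`, `θ⁰`.

The differential (in)equalities hold for a.e. time, with all test functions.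
Here `φt`, `θt` are the weak time derivatives and `φH`, `θH` are `φ`, `θ`
regarded as elements of `L²((0,T), H¹(Ω))`. -/
def IsSolution {d M : ℕ} {Ω : Set (E d)} (P : Parameters M) (T : ℝ)
    (φ0 : Fin M → L2 Ω) (θ0 : L2 Ω) (φ : ℝ → Fin M → L2 Ω) (θ : ℝ → L2 Ω) : Prop :=
  ∃ (φt : ℝ → Fin M → L2 Ω) (θt : ℝ → L2 Ω) (φH : ℝ → Fin M → H1 Ω) (θH : ℝ → H1 Ω),
    IsTimeSobolev T φ φt ∧ IsTimeSobolev T θ θt ∧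
    MemLp φH 2 (volume.restrict (Set.Ioo 0 T)) ∧
    MemLp θH 2 (volume.restrict (Set.Ioo 0 T)) ∧
    (∀ᵐ t ∂(volume.restrict (Set.Ioo 0 T)),
      (∀ α, toL2 (φH t α) = φ t α) ∧ toL2 (θH t) = θ t) ∧
    -- positivity of the inverse temperature
    (∀ᵐ t ∂(volume.restrict (Set.Ioo 0 T)), ∀ᵐ x ∂(volume.restrict Ω), 0 < θ t x) ∧
    -- initial conditions
    φ 0 = φ0 ∧ θ 0 = θ0 ∧
    -- variational inequality for the phase field
    (∀ᵐ t ∂(volume.restrict (Set.Ioo 0 T)), ∀ v : Fin M → H1 Ω,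
      0 ≤ (((∫ x in Ω, ∑ α, (P.ε * P.β * φt t α x + P.Ltilde α - θ t x * P.L α
                + 1 / P.ε * (K M).mulVec (fun γ => φ t γ x) α) * (toL2 (v α) x - φ t α x))
            + P.ε * ∫ x in Ω, ∑ α,
                inner ℝ (grad (φH t α) x) (grad (v α) x - grad (φH t α) x) : ℝ) : EReal)
          + chi (gibbsSet Ω M) v - chi (gibbsSet Ω M) (φH t)) ∧
    -- energy balance; `-∑ L_α ∂ₜφ_α - c_v θ⁻² ∂ₜθ` is the time derivative of `e`
    (∀ᵐ t ∂(volume.restrict (Set.Ioo 0 T)), ∀ w : H1 Ω,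
      Integrable (fun x => 1 / (θ t x) ^ 2 * θt t x * toL2 w x) (volume.restrict Ω) ∧
      (∫ x in Ω, (- (∑ α, P.L α * φt t α x) - P.cv * (1 / (θ t x) ^ 2 * θt t x)) * toL2 w x)
        - P.κ * ∫ x in Ω, inner ℝ (grad (θH t) x) (grad w x) = 0)

end PenroseFife

end

noncomputable section

namespace PenroseFife

open Filter Topology

/-! Formally the entropy rate is the sum of a phase part and `c_v (-ln θ)_t`. The variational
inequality taken in the direction `φ_t` gives `εβ‖φ_t‖² - (θ L, φ_t)` for the phase part. The energy
balance tested with `θ` gives `(L·φ_t, θ) + κ‖∇θ‖²` for the other. The coupling terms cancel and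
what remains is nonnegative. Two points need care.

The direction `φ_t` is admissible with equality: since `φ` is differentiable into `H¹` and stays in
the Gibbs set, `φ(s)` may be inserted as a competitor for `s` on both sides of `t`, so a nonnegative
expression has an interior minimum at `s = t` (`variational_eq_of_hasDerivAt`).

The function `-ln θ` is singular where `θ` vanishes, and positivity of `θ` is known only for almost
every time. It is therefore replaced by `regLog b`, i.e. `-½ ln(θ² + b²)`, whose integral is
differentiable and Lipschitz on `L²`. The matching test function is `regId b θ`, i.e. `θ³/(θ² +
b²)`: divided by `θ²` it is minus the derivative of `regLog b`. It lies in `H¹` by the chain rule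
(`exists_H1_comp`, by mollification), it increases with `θ`, so diffusion still has the right sign,
and it differs from `θ` by at most `b`. The cancellation thus fails only by `(L·φ_t, regId b θ -
θ)`, which Young's inequality absorbs into `εβ‖φ_t‖²` at the cost of `C b²`, with `C` independent of
time and of `b` (`exists_entropy_rate_bound`).

The fundamental theorem of calculus for `H¹(0,T;X)` makes the regularised entropy absolutely
continuous in time, so the rate bound integrates (`exists_regEntropy_le`). As `b` decreases to `0`,
`regLog b` increases to `-ln θ`, with value `+∞` at `θ = 0`, and monotone convergence
(`tendsto_regEntropy`) passes the inequality to the extended-valued entropy. -/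

/-- Almost everywhere convergence together with a bound of the norms of the approximants by the
norm of the limit yields convergence in `L¹`. -/
theorem tendsto_integral_norm_sub_of_ae {X F : Type*} [MeasurableSpace X] {μ : Measure X}
    [NormedAddCommGroup F] {G : ℕ → X → F} {g : X → F}
    (hG : ∀ n, Integrable (G n) μ) (hg : Integrable g μ)
    (hle : ∀ n, ∫ x, ‖G n x‖ ∂μ ≤ ∫ x, ‖g x‖ ∂μ)
    (hlim : ∀ᵐ x ∂μ, Tendsto (fun n => G n x) atTop (𝓝 (g x))) :
    Tendsto (fun n => ∫ x, ‖G n x - g x‖ ∂μ) atTop (𝓝 0) := by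
  -- By the triangle inequality this integrand lies between `0` and `2‖g‖`, so dominated convergence
  -- applies although the `G n` have no common majorant.
  have h1 : Tendsto (fun n => ∫ x, (‖G n x‖ + ‖g x‖ - ‖G n x - g x‖) ∂μ) atTop
      (𝓝 (∫ x, 2 * ‖g x‖ ∂μ)) := by
    refine tendsto_integral_of_dominated_convergence (fun x => 2 * ‖g x‖) ?_
      (hg.norm.const_mul 2) ?_ ?_
    · intro n
      exact (((hG n).norm.add hg.norm).sub ((hG n).sub hg).norm).aestronglyMeasurable
    · intro n
      refine Eventually.of_forall fun x => ?_
      have := norm_sub_le (G n x) (g x)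
      have h0 : ‖G n x‖ ≤ ‖G n x - g x‖ + ‖g x‖ := by simpa using norm_add_le (G n x - g x) (g x)
      rw [Real.norm_eq_abs, abs_of_nonneg (by linarith)]
      linarith
    · filter_upwards [hlim] with x hx
      have := (hx.norm.add_const ‖g x‖).sub (hx.sub_const (g x)).norm
      simpa [two_mul] using this
  have h2 : Tendsto (fun n => ∫ x, 2 * ‖g x‖ ∂μ - ∫ x, (‖G n x‖ + ‖g x‖ - ‖G n x - g x‖) ∂μ)
      atTop (𝓝 0) := by
    have := (tendsto_const_nhds (x := ∫ x, 2 * ‖g x‖ ∂μ)).sub h1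
    rwa [sub_self] at this
  refine squeeze_zero (fun n => integral_nonneg fun x => norm_nonneg _) (fun n => ?_) h2
  have h3 : ∫ x, (‖G n x‖ + ‖g x‖ - ‖G n x - g x‖) ∂μ
      = ∫ x, ‖G n x‖ ∂μ + ∫ x, ‖g x‖ ∂μ - ∫ x, ‖G n x - g x‖ ∂μ := by
    rw [← integral_add (hG n).norm hg.norm]
    exact integral_sub ((hG n).norm.add hg.norm) ((hG n).sub hg).norm
  rw [h3, integral_const_mul]
  linarith [hle n]

/-! ### Mollification and convergence in `L¹` -/

section Mollification

variable {d : ℕ}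

/-- A sequence of bump functions shrinking to the origin. -/
def bump (d n : ℕ) : ContDiffBump (0 : E d) where
  rIn := 1 / (2 * (n + 1))
  rOut := 1 / (n + 1)
  rIn_pos := by positivity
  rIn_lt_rOut := by
    rw [div_lt_div_iff₀ (by positivity) (by positivity)]
    have : (0 : ℝ) ≤ n := by positivity
    linarith

theorem tendsto_rOut_bump (d : ℕ) : Tendsto (fun n => (bump d n).rOut) atTop (𝓝 0) :=
  tendsto_one_div_add_atTop_nhds_zero_nat

/-- The mollification of a function. -/
def mollify (n : ℕ) (U : E d → ℝ) : E d → ℝ :=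
  convolution ((bump d n).normed volume) U (ContinuousLinearMap.lsmul ℝ ℝ) volume

theorem mollify_apply (n : ℕ) (U : E d → ℝ) (x : E d) :
    mollify n U x = ∫ y, (bump d n).normed volume (x - y) * U y :=
  convolution_lsmul_swap

theorem contDiff_normed_bump (n : ℕ) {k : ℕ∞} : ContDiff ℝ k ((bump d n).normed volume) :=
  (bump d n).contDiff_normed

theorem hasCompactSupport_normed_bump (n : ℕ) :
    HasCompactSupport ((bump d n).normed (volume : Measure (E d))) :=
  (bump d n).hasCompactSupport_normed

theorem contDiff_mollify (n : ℕ) {U : E d → ℝ} (hU : Integrable U) :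
    ContDiff ℝ 1 (mollify n U) :=
  (hasCompactSupport_normed_bump n).contDiff_convolution_left (n := 1) _
    (contDiff_normed_bump n) hU.locallyIntegrable

theorem integrable_mollify (n : ℕ) {U : E d → ℝ} (hU : Integrable U) :
    Integrable (mollify n U) :=
  (((contDiff_normed_bump (k := 0) n).continuous.integrable_of_hasCompactSupport
    (hasCompactSupport_normed_bump n))).integrable_convolution _ hU

/-- Lebesgue differentiation; it needs the inner and outer radii of the bumps to be comparable, and
here their ratio is exactly `2`. -/
theorem ae_tendsto_mollify {U : E d → ℝ} (hU : Integrable U) :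
    ∀ᵐ x, Tendsto (fun n => mollify n U x) atTop (𝓝 (U x)) := by
  refine ContDiffBump.ae_convolution_tendsto_right_of_locallyIntegrable (K := 2)
    (tendsto_rOut_bump d) (Eventually.of_forall fun n => ?_) hU.locallyIntegrable
  simp only [bump]
  apply le_of_eq
  field_simp

theorem integral_norm_mollify_le (n : ℕ) {U : E d → ℝ} (hU : Integrable U) :
    ∫ x, ‖mollify n U x‖ ≤ ∫ x, ‖U x‖ := by
  have hρ : Integrable ((bump d n).normed (volume : Measure (E d))) :=
    (contDiff_normed_bump (k := 0) n).continuous.integrable_of_hasCompactSupport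
      (hasCompactSupport_normed_bump n)
  have h1 : ∫ x, mollify n (fun x => ‖U x‖) x = ∫ x, ‖U x‖ := by
    have := integral_convolution (ContinuousLinearMap.lsmul ℝ ℝ) (μ := volume) (ν := volume)
      hρ hU.norm
    rw [(bump d n).integral_normed] at this
    simpa [mollify] using this
  rw [← h1]
  refine integral_mono (integrable_mollify n hU).norm (integrable_mollify n hU.norm) fun x => ?_
  simp only [mollify_apply]
  refine (norm_integral_le_integral_norm _).trans (le_of_eq ?_)
  congr 1
  ext y
  rw [norm_mul, Real.norm_of_nonneg ((bump d n).nonneg_normed _)]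

theorem tendsto_integral_norm_mollify_sub {U : E d → ℝ} (hU : Integrable U) :
    Tendsto (fun n => ∫ x, ‖mollify n U x - U x‖) atTop (𝓝 0) :=
  tendsto_integral_norm_sub_of_ae (fun n => integrable_mollify n hU) hU
    (fun n => integral_norm_mollify_le n hU) (ae_tendsto_mollify hU)

theorem fderiv_mollify (n : ℕ) {U : E d → ℝ} (hU : Integrable U) (x v : E d) :
    fderiv ℝ (mollify n U) x v = ∫ y, fderiv ℝ ((bump d n).normed volume) (x - y) v * U y := by
  have h := (hasCompactSupport_normed_bump (d := d) n).hasFDerivAt_convolution_left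
    (ContinuousLinearMap.lsmul ℝ ℝ) (contDiff_normed_bump (k := 1) n)
    (hU.locallyIntegrable) x
  rw [show fderiv ℝ (mollify n U) x = _ from h.fderiv, convolution_eq_swap,
    ContinuousLinearMap.integral_apply]
  · rfl
  · have := ((hasCompactSupport_normed_bump (d := d) n).fderiv ℝ).convolutionExists_left
      ((ContinuousLinearMap.lsmul ℝ ℝ).precompL (E d) : (E d →L[ℝ] ℝ) →L[ℝ] ℝ →L[ℝ] (E d →L[ℝ] ℝ))
      ((contDiff_normed_bump (k := 1) n).continuous_fderiv one_ne_zero)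
      (hU.locallyIntegrable) x
    exact this.integrable_swap

end Mollification

/-! ### Chain rule and uniqueness for weak gradients -/

section ChainRule

variable {d : ℕ} {Ω : Set (E d)}

theorem integrable_indicator_of_L2 (hΩ : IsOpen Ω) [IsFiniteMeasure (volume.restrict Ω)]
    (u : L2 Ω) : Integrable (Ω.indicator u) :=
  (integrable_indicator_iff hΩ.measurableSet).2 ((Lp.memLp u).integrable (by norm_num))

theorem integrable_indicator_coord (hΩ : IsOpen Ω) [IsFiniteMeasure (volume.restrict Ω)]
    (g : L2Vec Ω) (i : Fin d) : Integrable (Ω.indicator fun x => g x i) :=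
  (integrable_indicator_iff hΩ.measurableSet).2
    (((EuclideanSpace.proj (𝕜 := ℝ) i : E d →L[ℝ] ℝ).comp_memLp' (Lp.memLp g)).integrable
      (by norm_num))

/-- The gradient of a mollified function is the mollified weak gradient, away from the boundary. -/
theorem IsWeakGradient.fderiv_mollify (hΩ : IsOpen Ω) [IsFiniteMeasure (volume.restrict Ω)]
    {u : L2 Ω} {g : L2Vec Ω} (h : IsWeakGradient u g) (i : Fin d) (n : ℕ) {x : E d}
    (hx : Metric.closedBall x (bump d n).rOut ⊆ Ω) :
    fderiv ℝ (mollify n (Ω.indicator u)) x (EuclideanSpace.single i 1)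
      = mollify n (Ω.indicator fun y => g y i) x := by
  set ρ : E d → ℝ := (bump d n).normed volume with hρ
  have hρs : ContDiff ℝ ∞ ρ := (bump d n).contDiff_normed
  have hcs : tsupport (fun y => ρ (x - y)) ⊆ Metric.closedBall x (bump d n).rOut := by
    refine closure_minimal (fun y hy => ?_) Metric.isClosed_closedBall
    have h1 : x - y ∈ Function.support ρ := hy
    rw [hρ, (bump d n).support_normed_eq] at h1
    rw [Metric.mem_closedBall, dist_comm, dist_eq_norm]
    exact (mem_ball_zero_iff.1 h1).le
  have htest : IsTestFunction Ω (fun y => ρ (x - y)) := by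
    refine ⟨hρs.comp (contDiff_const.sub contDiff_id), ?_, hcs.trans hx⟩
    exact IsCompact.of_isClosed_subset (isCompact_closedBall _ _) isClosed_closure hcs
  -- Reflecting the kernel produces a minus sign, which cancels the one in the definition of the
  -- weak gradient.
  have hfd : ∀ y v, fderiv ℝ (fun y => ρ (x - y)) y v = - fderiv ℝ ρ (x - y) v := by
    intro y v
    have h1 : HasFDerivAt (fun y => ρ (x - y)) ((fderiv ℝ ρ (x - y)).comp
        (-ContinuousLinearMap.id ℝ (E d))) y := by
      exact HasFDerivAt.comp y (hρs.differentiable (by simp) (x - y)).hasFDerivAt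
        ((hasFDerivAt_id y).const_sub x)
    rw [h1.fderiv]
    simp
  have hw := h _ htest i
  rw [PenroseFife.fderiv_mollify n (integrable_indicator_of_L2 hΩ u), mollify_apply]
  have h1 : ∀ (a b : E d → ℝ), ∫ y, a y * Ω.indicator b y = ∫ y in Ω, b y * a y := by
    intro a b
    rw [← integral_indicator hΩ.measurableSet]
    congr 1
    ext y
    by_cases hy : y ∈ Ω <;> simp [hy, mul_comm]
  rw [h1, h1]
  simp only [hfd, mul_neg, integral_neg] at hw
  exact neg_injective hw

theorem tendsto_integral_of_le_mul {X : Type*} [MeasurableSpace X] {μ : Measure X}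
    {F : ℕ → X → ℝ} {f : X → ℝ} {b : ℕ → X → ℝ}
    (hF : ∀ n, Integrable (F n) μ) (hf : Integrable f μ) (hb : ∀ n, Integrable (b n) μ)
    (hle : ∀ n x, |F n x - f x| ≤ b n x) (hlim : Tendsto (fun n => ∫ x, b n x ∂μ) atTop (𝓝 0)) :
    Tendsto (fun n => ∫ x, F n x ∂μ) atTop (𝓝 (∫ x, f x ∂μ)) := by
  rw [tendsto_iff_norm_sub_tendsto_zero]
  refine squeeze_zero (fun n => norm_nonneg _) (fun n => ?_) hlim
  rw [← integral_sub (hF n) hf]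
  exact (norm_integral_le_integral_norm _).trans
    (integral_mono ((hF n).sub hf).norm (hb n) fun x => hle n x)

/-- The chain rule for weak gradients, in integrated form. -/
theorem IsWeakGradient.integral_comp_mul_fderiv (hΩ : IsOpen Ω)
    [IsFiniteMeasure (volume.restrict Ω)] {u : L2 Ω} {g : L2Vec Ω} (h : IsWeakGradient u g)
    {f : ℝ → ℝ} (hf : ContDiff ℝ 1 f) {C : ℝ} (hC : ∀ s, |deriv f s| ≤ C)
    {ζ : E d → ℝ} (hζ : IsTestFunction Ω ζ) (i : Fin d) :
    ∫ x in Ω, f (u x) * fderiv ℝ ζ x (EuclideanSpace.single i 1)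
      = - ∫ x in Ω, deriv f (u x) * g x i * ζ x := by
  set e : E d := EuclideanSpace.single i 1
  set U : E d → ℝ := Ω.indicator u with hUdef
  set G : E d → ℝ := Ω.indicator fun y => g y i with hGdef
  have hU : Integrable U := integrable_indicator_of_L2 hΩ u
  have hG : Integrable G := integrable_indicator_coord hΩ g i
  have hC0 : 0 ≤ C := (abs_nonneg _).trans (hC 0)
  have hLip : ∀ a b, |f a - f b| ≤ C * |a - b| := fun a b => by
    have := Convex.norm_image_sub_le_of_norm_deriv_le (s := Set.univ) (f := f) (C := C)
      (fun x _ => hf.differentiable one_ne_zero x) (fun x _ => hC x) convex_univ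
      (Set.mem_univ b) (Set.mem_univ a)
    simpa using this
  have hdf : Continuous (deriv f) := hf.continuous_deriv le_rfl
  have hζc : Continuous ζ := hζ.1.continuous
  have hζ'c : Continuous fun x => fderiv ℝ ζ x e :=
    (hζ.1.continuous_fderiv (by simp)).clm_apply continuous_const
  have hζ's : HasCompactSupport fun x => fderiv ℝ ζ x e := hζ.2.1.fderiv_apply ℝ e
  obtain ⟨B, hB⟩ := hζc.bounded_above_of_compact_support hζ.2.1
  obtain ⟨B', hB'⟩ := hζ'c.bounded_above_of_compact_support hζ's
  have hB0 : 0 ≤ B := (norm_nonneg _).trans (hB 0)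
  have hB'0 : 0 ≤ B' := (norm_nonneg _).trans (hB' 0)
  have hUn : ∀ n, ContDiff ℝ 1 (mollify n U) := fun n => contDiff_mollify n hU
  have hGn : ∀ n, ContDiff ℝ 1 (mollify n G) := fun n => contDiff_mollify n hG
  -- integrability
  have hi1 : Integrable fun x => f (U x) * fderiv ℝ ζ x e := by
    -- Off `Ω` the function `f ∘ U` equals `f 0`, which need not be integrable; the constant is
    -- paired with the compactly supported factor, and the rest is controlled by `|U|`.
    have h1 : Integrable fun x => f 0 * fderiv ℝ ζ x e :=
      (hζ'c.integrable_of_hasCompactSupport hζ's).const_mul _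
    have h2 : Integrable fun x => (f (U x) - f 0) * fderiv ℝ ζ x e := by
      refine (hU.norm.const_mul (C * B')).mono'
        (((hf.continuous.comp_aestronglyMeasurable hU.1).sub
          aestronglyMeasurable_const).mul hζ'c.aestronglyMeasurable)
        (Eventually.of_forall fun x => ?_)
      rw [norm_mul]
      have := hLip (U x) 0
      rw [sub_zero] at this
      calc ‖f (U x) - f 0‖ * ‖fderiv ℝ ζ x e‖ ≤ (C * |U x|) * B' := by
            gcongr
            · exact this
            · exact hB' x
        _ = C * B' * ‖U x‖ := by rw [Real.norm_eq_abs]; ring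
    refine (h1.add h2).congr (Eventually.of_forall fun x => ?_)
    simp only [Pi.add_apply]
    ring
  have hi2 : Integrable fun x => deriv f (U x) * G x * ζ x := by
    refine (hG.norm.const_mul (C * B)).mono' (((hdf.comp_aestronglyMeasurable hU.1).mul hG.1).mul
      hζc.aestronglyMeasurable) (Eventually.of_forall fun x => ?_)
    rw [norm_mul, norm_mul]
    calc ‖deriv f (U x)‖ * ‖G x‖ * ‖ζ x‖ ≤ C * ‖G x‖ * B := by
          gcongr
          · exact hC _
          · exact hB x
      _ = _ := by ring
  have hi1n : ∀ n, Integrable fun x => f (mollify n U x) * fderiv ℝ ζ x e := fun n =>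
    ((hf.continuous.comp (hUn n).continuous).mul hζ'c).integrable_of_hasCompactSupport
      hζ's.mul_left
  have hi2n : ∀ n, Integrable fun x => deriv f (mollify n U x) * mollify n G x * ζ x := fun n =>
    (((hdf.comp (hUn n).continuous).mul (hGn n).continuous).mul hζc).integrable_of_hasCompactSupport
      hζ.2.1.mul_left
  have hi3n : ∀ n, Integrable fun x => deriv f (mollify n U x) * G x * ζ x := fun n => by
    refine (hG.norm.const_mul (C * B)).mono' (((hdf.comp
      (hUn n).continuous).aestronglyMeasurable.mul hG.1).mul
      hζc.aestronglyMeasurable) (Eventually.of_forall fun x => ?_)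
    rw [norm_mul, norm_mul]
    calc ‖deriv f (mollify n U x)‖ * ‖G x‖ * ‖ζ x‖ ≤ C * ‖G x‖ * B := by
          gcongr
          · exact hC _
          · exact hB x
      _ = _ := by ring
  -- limits
  have hl1 : Tendsto (fun n => ∫ x, f (mollify n U x) * fderiv ℝ ζ x e) atTop
      (𝓝 (∫ x, f (U x) * fderiv ℝ ζ x e)) := by
    refine tendsto_integral_of_le_mul (b := fun n x => C * B' * ‖mollify n U x - U x‖) hi1n hi1
      (fun n => ((integrable_mollify n hU).sub hU).norm.const_mul _) (fun n x => ?_) ?_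
    · rw [← sub_mul, abs_mul]
      calc |f (mollify n U x) - f (U x)| * |fderiv ℝ ζ x e|
          ≤ (C * |mollify n U x - U x|) * B' := by
            gcongr
            · exact hLip _ _
            · exact hB' x
        _ = _ := by rw [Real.norm_eq_abs]; ring
    · simp only [integral_const_mul]
      simpa using (tendsto_integral_norm_mollify_sub hU).const_mul (C * B')
  have hl2 : Tendsto (fun n => ∫ x, deriv f (mollify n U x) * mollify n G x * ζ x) atTop
      (𝓝 (∫ x, deriv f (U x) * G x * ζ x)) := by
    -- The product of two convergent sequences is split: the error in `G` is small in `L¹` with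
    -- bounded coefficients, while the error in `deriv f` tends to zero only almost everywhere and
    -- is handled by domination with `|G|`.
    have ha : Tendsto (fun n => ∫ x, deriv f (mollify n U x) * (mollify n G x - G x) * ζ x) atTop
        (𝓝 (∫ x, (0 : ℝ) ∂(volume : Measure (E d)))) := by
      refine tendsto_integral_of_le_mul (b := fun n x => C * B * ‖mollify n G x - G x‖)
        (fun n => ?_) (integrable_zero _ _ _)
        (fun n => ((integrable_mollify n hG).sub hG).norm.const_mul _) (fun n x => ?_) ?_
      · refine ((hi2n n).sub (hi3n n)).congr (Eventually.of_forall fun x => ?_)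
        simp only [Pi.sub_apply]
        ring
      · rw [sub_zero, abs_mul, abs_mul]
        calc |deriv f (mollify n U x)| * |mollify n G x - G x| * |ζ x|
            ≤ C * |mollify n G x - G x| * B := by
              gcongr
              · exact hC _
              · exact hB x
          _ = _ := by rw [Real.norm_eq_abs]; ring
      · simp only [integral_const_mul]
        simpa using (tendsto_integral_norm_mollify_sub hG).const_mul (C * B)
    have hb : Tendsto (fun n => ∫ x, deriv f (mollify n U x) * G x * ζ x) atTop
        (𝓝 (∫ x, deriv f (U x) * G x * ζ x)) := by
      refine tendsto_integral_of_dominated_convergence (fun x => C * B * ‖G x‖)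
        (fun n => (hi3n n).1) (hG.norm.const_mul _) (fun n => Eventually.of_forall fun x => ?_) ?_
      · rw [norm_mul, norm_mul]
        calc ‖deriv f (mollify n U x)‖ * ‖G x‖ * ‖ζ x‖ ≤ C * ‖G x‖ * B := by
              gcongr
              · exact hC _
              · exact hB x
          _ = _ := by ring
      · filter_upwards [ae_tendsto_mollify hU] with x hx
        exact ((hdf.continuousAt.tendsto.comp hx).mul_const _).mul_const _
    have := ha.add hb
    rw [integral_zero, zero_add] at this
    refine this.congr fun n => ?_
    rw [← integral_add]
    · congr 1
      ext x
      ring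
    · refine ((hi2n n).sub (hi3n n)).congr (Eventually.of_forall fun x => ?_)
      simp only [Pi.sub_apply]
      ring
    · exact hi3n n
  -- integration by parts for the mollified functions
  have heq : ∀ᶠ n in atTop, ∫ x, f (mollify n U x) * fderiv ℝ ζ x e
      = - ∫ x, deriv f (mollify n U x) * mollify n G x * ζ x := by
    -- The identity between mollified gradients holds only at distance more than the mollification
    -- radius from the boundary; on the compact support of `ζ` this is satisfied for all large `n`.
    obtain ⟨δ, hδ, hsub⟩ := hζ.2.1.isCompact.exists_cthickening_subset_open hΩ hζ.2.2
    filter_upwards [(tendsto_rOut_bump d).eventually_lt_const hδ] with n hn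
    have hder : ∀ x, fderiv ℝ (fun x => f (mollify n U x)) x e * ζ x
        = deriv f (mollify n U x) * mollify n G x * ζ x := by
      intro x
      by_cases hx : x ∈ tsupport ζ
      · have h1 : Metric.closedBall x (bump d n).rOut ⊆ Ω :=
          ((Metric.closedBall_subset_closedBall hn.le).trans
            (Metric.closedBall_subset_cthickening hx δ)).trans hsub
        rw [← h.fderiv_mollify hΩ i n h1]
        have h2 : HasFDerivAt (fun x => f (mollify n U x))
            (deriv f (mollify n U x) • fderiv ℝ (mollify n U) x) x :=
          (hf.differentiable one_ne_zero _).hasDerivAt.comp_hasFDerivAt x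
            ((hUn n).differentiable one_ne_zero x).hasFDerivAt
        rw [h2.fderiv]
        rfl
      · rw [image_eq_zero_of_notMem_tsupport hx, mul_zero, mul_zero]
    rw [integral_mul_fderiv_eq_neg_fderiv_mul_of_integrable]
    · simp only [hder]
    · simp only [hder]
      exact hi2n n
    · exact hi1n n
    · exact ((hf.continuous.comp (hUn n).continuous).mul hζc).integrable_of_hasCompactSupport
        hζ.2.1.mul_left
    · exact fun x _ => (hf.comp (hUn n)).differentiable one_ne_zero x
    · exact fun x _ => hζ.1.differentiable (by simp) x
  have hfin : ∫ x, f (U x) * fderiv ℝ ζ x e = - ∫ x, deriv f (U x) * G x * ζ x :=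
    tendsto_nhds_unique_of_eventuallyEq hl1 hl2.neg heq
  have hζ0 : ∀ x ∉ Ω, ζ x = 0 := fun x hx =>
    image_eq_zero_of_notMem_tsupport fun hx' => hx (hζ.2.2 hx')
  have hζ'0 : ∀ x ∉ Ω, fderiv ℝ ζ x e = 0 := fun x hx => by
    rw [image_eq_zero_of_notMem_tsupport (f := fderiv ℝ ζ)
      fun hx' => hx (hζ.2.2 (tsupport_fderiv_subset ℝ hx'))]
    rfl
  rw [← integral_indicator hΩ.measurableSet, ← integral_indicator hΩ.measurableSet]
  have e1 : ∀ x, Ω.indicator (fun x => f (u x) * fderiv ℝ ζ x e) x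
      = f (U x) * fderiv ℝ ζ x e := by
    intro x
    by_cases hx : x ∈ Ω
    · rw [hUdef, Set.indicator_of_mem hx, Set.indicator_of_mem hx]
    · rw [Set.indicator_of_notMem hx, hζ'0 x hx, mul_zero]
  have e2 : ∀ x, Ω.indicator (fun x => deriv f (u x) * g x i * ζ x) x
      = deriv f (U x) * G x * ζ x := by
    intro x
    by_cases hx : x ∈ Ω
    · rw [hUdef, hGdef, Set.indicator_of_mem hx, Set.indicator_of_mem hx, Set.indicator_of_mem hx]
    · rw [Set.indicator_of_notMem hx, hζ0 x hx, mul_zero]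
  simp only [e1, e2]
  exact hfin

/-- Composition of an element of `H¹(Ω)` with a `C¹` function with bounded derivative. -/
theorem exists_H1_comp (hΩ : IsOpen Ω) [IsFiniteMeasure (volume.restrict Ω)] (u : H1 Ω)
    {f : ℝ → ℝ} (hf : ContDiff ℝ 1 f) {C : ℝ} (hC : ∀ s, |deriv f s| ≤ C) :
    ∃ w : H1 Ω, (∀ᵐ x ∂(volume.restrict Ω), toL2 w x = f (toL2 u x)) ∧
      ∀ᵐ x ∂(volume.restrict Ω), grad w x = deriv f (toL2 u x) • grad u x := by
  have hLip : ∀ a b, |f a - f b| ≤ C * |a - b| := fun a b => by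
    have := Convex.norm_image_sub_le_of_norm_deriv_le (s := Set.univ) (f := f) (C := C)
      (fun x _ => hf.differentiable one_ne_zero x) (fun x _ => hC x) convex_univ
      (Set.mem_univ b) (Set.mem_univ a)
    simpa using this
  have hdf : Continuous (deriv f) := hf.continuous_deriv le_rfl
  have h1 : MemLp (fun x => f (toL2 u x)) 2 (volume.restrict Ω) := by
    have h2 : MemLp (fun x => f (toL2 u x) - f 0) 2 (volume.restrict Ω) := by
      refine (Lp.memLp (toL2 u)).of_le_mul (c := C)
        ((hf.continuous.comp_aestronglyMeasurable (Lp.memLp (toL2 u)).1).sub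
          aestronglyMeasurable_const) (Eventually.of_forall fun x => ?_)
      simpa using hLip (toL2 u x) 0
    refine (h2.add (memLp_const (f 0))).ae_eq (Eventually.of_forall fun x => ?_)
    simp
  have h2 : MemLp (fun x => deriv f (toL2 u x) • grad u x) 2 (volume.restrict Ω) := by
    refine (Lp.memLp (grad u)).of_le_mul (c := C)
      ((hdf.comp_aestronglyMeasurable (Lp.memLp (toL2 u)).1).smul (Lp.memLp (grad u)).1)
      (Eventually.of_forall fun x => ?_)
    rw [norm_smul]
    gcongr
    exact hC _
  refine ⟨⟨WithLp.toLp 2 (h1.toLp _, h2.toLp _), ?_⟩, h1.coeFn_toLp, h2.coeFn_toLp⟩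
  intro ζ hζ i
  have h3 := IsWeakGradient.integral_comp_mul_fderiv hΩ u.2 hf hC hζ i
  have e1 : ∫ x in Ω, (h1.toLp _ : L2 Ω) x * fderiv ℝ ζ x (EuclideanSpace.single i 1)
      = ∫ x in Ω, f (toL2 u x) * fderiv ℝ ζ x (EuclideanSpace.single i 1) := by
    refine integral_congr_ae ?_
    filter_upwards [h1.coeFn_toLp] with x hx
    rw [hx]
  have e2 : ∫ x in Ω, (h2.toLp _ : L2Vec Ω) x i * ζ x
      = ∫ x in Ω, deriv f (toL2 u x) * grad u x i * ζ x := by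
    refine integral_congr_ae ?_
    filter_upwards [h2.coeFn_toLp] with x hx
    rw [hx, PiLp.smul_apply, smul_eq_mul]
  exact e1.trans (h3.trans (congrArg Neg.neg e2.symm))

/-- The weak gradient is unique. -/
theorem toL2_injective (hΩ : IsOpen Ω) [IsFiniteMeasure (volume.restrict Ω)] :
    Function.Injective (toL2 : H1 Ω → L2 Ω) := by
  intro u v huv
  have hg : grad u = grad v := by
    have h1 : ∀ i : Fin d, ∀ᵐ x ∂(volume.restrict Ω), grad u x i - grad v x i = 0 := by
      intro i
      rw [ae_restrict_iff' hΩ.measurableSet]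
      have hu := integrable_indicator_coord hΩ (grad u) i
      have hv := integrable_indicator_coord hΩ (grad v) i
      rw [integrable_indicator_iff hΩ.measurableSet] at hu hv
      refine hΩ.ae_eq_zero_of_integral_contDiff_smul_eq_zero
        (hu.sub hv).locallyIntegrableOn fun ζ h1 h2 h3 => ?_
      have hζ : IsTestFunction Ω ζ := ⟨h1, h2, h3⟩
      have hu' := u.2 ζ hζ i
      have hv' := v.2 ζ hζ i
      change ∫ x in Ω, toL2 u x * _ = - ∫ x in Ω, grad u x i * _ at hu'
      change ∫ x in Ω, toL2 v x * _ = - ∫ x in Ω, grad v x i * _ at hv'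
      rw [huv] at hu'
      have h4 : ∫ x in Ω, grad u x i * ζ x = ∫ x in Ω, grad v x i * ζ x := by linarith
      have h5 : ∫ x in Ω, ζ x • (grad u x i - grad v x i) = 0 := by
        have : ∀ x, ζ x • (grad u x i - grad v x i) = grad u x i * ζ x - grad v x i * ζ x := by
          intro x
          rw [smul_eq_mul]
          ring
        simp only [this]
        rw [integral_sub (integrable_coord_mul _ hζ i) (integrable_coord_mul _ hζ i), h4, sub_self]
      rw [← setIntegral_eq_integral_of_forall_compl_eq_zero (s := Ω)]
      · exact h5
      · intro x hx
        rw [image_eq_zero_of_notMem_tsupport fun hx' => hx (h3 hx'), zero_smul]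
    refine Lp.ext ?_
    filter_upwards [ae_all_iff.2 h1] with x hx
    ext i
    exact sub_eq_zero.1 (hx i)
  refine Subtype.ext ?_
  refine (WithLp.ofLp_injective 2) (Prod.ext huv hg)

end ChainRule

/-! ### Sobolev functions of time: fundamental theorem of calculus and absolute continuity -/

section TimeSobolev

/-- A smooth approximation of the unit step at `s`, with transition in `[s, s + 1/n]`. -/
def smoothStep (s : ℝ) (n : ℕ) (τ : ℝ) : ℝ := Real.smoothTransition (n * (τ - s))

theorem contDiff_smoothStep (s : ℝ) (n : ℕ) {k : ℕ∞} : ContDiff ℝ k (smoothStep s n) :=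
  Real.smoothTransition.contDiff.comp (contDiff_const.mul (contDiff_id.sub contDiff_const))

theorem monotone_smoothStep (s : ℝ) (n : ℕ) : Monotone (smoothStep s n) := fun a b hab =>
  Real.smoothTransition.monotone (by gcongr)

theorem smoothStep_of_le {s τ : ℝ} (n : ℕ) (h : τ ≤ s) : smoothStep s n τ = 0 :=
  Real.smoothTransition.zero_of_nonpos
    (mul_nonpos_of_nonneg_of_nonpos (Nat.cast_nonneg n) (sub_nonpos.2 h))

theorem smoothStep_of_ge {s τ : ℝ} {n : ℕ} (h : 1 ≤ n * (τ - s)) : smoothStep s n τ = 1 :=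
  Real.smoothTransition.one_of_one_le h

theorem eventually_one_lt_mul {r : ℝ} (hr : 0 < r) : ∀ᶠ n : ℕ in atTop, 1 < n * r := by
  filter_upwards [(tendsto_natCast_atTop_atTop (R := ℝ)).eventually_gt_atTop (1 / r)] with n hn
  rwa [div_lt_iff₀ hr] at hn

theorem deriv_smoothStep_of_lt {s τ : ℝ} (n : ℕ) (h : τ < s) : deriv (smoothStep s n) τ = 0 := by
  have : smoothStep s n =ᶠ[𝓝 τ] fun _ => 0 := by
    filter_upwards [Iio_mem_nhds h] with x hx using smoothStep_of_le n hx.le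
  rw [this.deriv_eq, deriv_const]

theorem deriv_smoothStep_of_gt {s τ : ℝ} {n : ℕ} (h : 1 < n * (τ - s)) :
    deriv (smoothStep s n) τ = 0 := by
  have hc : Continuous fun τ : ℝ => n * (τ - s) := by fun_prop
  have : smoothStep s n =ᶠ[𝓝 τ] fun _ => 1 := by
    filter_upwards [hc.continuousAt.eventually (lt_mem_nhds h)] with x hx
      using smoothStep_of_ge hx.le
  rw [this.deriv_eq, deriv_const]

variable {X : Type*} [NormedAddCommGroup X] [NormedSpace ℝ X]

theorem IsTimeSobolev.integrableOn {T : ℝ} {u u' : ℝ → X} (h : IsTimeSobolev T u u') :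
    IntegrableOn u (Set.Ioo 0 T) :=
  h.2.1.integrable (by norm_num)

theorem IsTimeSobolev.integrableOn_deriv {T : ℝ} {u u' : ℝ → X} (h : IsTimeSobolev T u u') :
    IntegrableOn u' (Set.Ioo 0 T) :=
  h.2.2.1.integrable (by norm_num)

/-- The derivatives of the steps form a one-sided approximate identity at `s`: they are nonnegative,
vanish outside `[s, s + 1/n]`, and have mass one as soon as `s + 1/n` is below `T`. -/
theorem tendsto_integral_deriv_smoothStep_smul [CompleteSpace X] {T s : ℝ}
    (hs : s ∈ Set.Ioo 0 T) {u : ℝ → X}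
    (hu : IntegrableOn u (Set.Ioo 0 T)) (hc : ContinuousAt u s) :
    Tendsto (fun n => ∫ τ in Set.Ioo 0 T, deriv (smoothStep s n) τ • u τ) atTop (𝓝 (u s)) := by
  refine tendsto_setIntegral_peak_smul_of_integrableOn_of_tendsto measurableSet_Ioo
    measurableSet_Ioo le_rfl self_mem_nhdsWithin (by simp) ?_ ?_ ?_ ?_ hu
    (hc.tendsto.mono_left nhdsWithin_le_nhds)
  · exact Eventually.of_forall fun n x _ => (monotone_smoothStep s n).deriv_nonneg
  · intro v hv hsv
    obtain ⟨r, hr, hrv⟩ := Metric.isOpen_iff.1 hv s hsv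
    rw [Metric.tendstoUniformlyOn_iff]
    intro ε hε
    filter_upwards [eventually_one_lt_mul hr] with n hn x hx
    have h0 : deriv (smoothStep s n) x = 0 := by
      have h1 : x ∉ Metric.ball s r := fun h => hx.2 (hrv h)
      rw [Metric.mem_ball, Real.dist_eq, not_lt, le_abs] at h1
      rcases h1 with h1 | h1
      · exact deriv_smoothStep_of_gt (hn.trans_le (by gcongr))
      · exact deriv_smoothStep_of_lt n (by linarith)
    simpa [h0] using hε
  · refine tendsto_const_nhds.congr' ?_
    filter_upwards [eventually_one_lt_mul (sub_pos.2 hs.2)] with n hn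
    have hT : (0 : ℝ) ≤ T := (hs.1.trans hs.2).le
    rw [← integral_Ioc_eq_integral_Ioo, ← intervalIntegral.integral_of_le hT,
      intervalIntegral.integral_deriv_eq_sub, smoothStep_of_ge hn.le,
      smoothStep_of_le n hs.1.le, sub_zero]
    · exact fun x _ => (contDiff_smoothStep s n (k := 1)).differentiable one_ne_zero x
    · exact ((contDiff_smoothStep s n (k := 1)).continuous_deriv le_rfl).intervalIntegrable _ _
  · exact Eventually.of_forall fun n =>
      ((contDiff_smoothStep s n (k := 1)).continuous_deriv le_rfl).aestronglyMeasurable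

theorem isTestFunction_smoothStep_sub {T s t : ℝ} (hs : 0 < s) (hst : s ≤ t) {n : ℕ}
    (hn : 1 < n * (T - t)) :
    IsTestFunction (Set.Ioo 0 T) (fun τ => smoothStep s n τ - smoothStep t n τ) := by
  have hn0 : (0 : ℝ) < n := by
    rcases Nat.eq_zero_or_pos n with h | h
    · norm_num [h] at hn
    · exact_mod_cast h
  have hsub : tsupport (fun τ => smoothStep s n τ - smoothStep t n τ)
      ⊆ Set.Icc s (t + 1 / n) := by
    refine closure_minimal (fun τ hτ => ?_) isClosed_Icc
    by_contra hcon
    rw [Set.mem_Icc, not_and_or, not_le, not_le] at hcon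
    apply hτ
    rcases hcon with h | h
    · simp only [smoothStep_of_le n h.le, smoothStep_of_le n (h.le.trans hst), sub_zero]
    · have h1 : 1 ≤ n * (τ - t) := by
        have h3 : 1 / (n : ℝ) ≤ τ - t := by linarith
        rwa [div_le_iff₀' hn0] at h3
      have h2 : 1 ≤ n * (τ - s) := h1.trans (by gcongr)
      simp only [smoothStep_of_ge h1, smoothStep_of_ge h2, sub_self]
  refine ⟨(contDiff_smoothStep s n).sub (contDiff_smoothStep t n),
    isCompact_Icc.of_isClosed_subset isClosed_closure hsub, hsub.trans fun τ hτ => ⟨?_, ?_⟩⟩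
  · exact hs.trans_le hτ.1
  · refine hτ.2.trans_lt ?_
    have : 1 / (n : ℝ) < T - t := by rwa [div_lt_iff₀' hn0]
    linarith

theorem tendsto_smoothStep_sub {s t : ℝ} (hst : s ≤ t) (τ : ℝ) :
    Tendsto (fun n => smoothStep s n τ - smoothStep t n τ) atTop
      (𝓝 ((Set.Ioc s t).indicator (fun _ => 1) τ)) := by
  rcases le_or_gt τ s with h | h
  · rw [Set.indicator_of_notMem fun h' => absurd h'.1 (not_lt.2 h)]
    refine tendsto_const_nhds.congr fun n => ?_
    rw [smoothStep_of_le n h, smoothStep_of_le n (h.trans hst), sub_zero]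
  rcases le_or_gt τ t with h' | h'
  · rw [Set.indicator_of_mem (show τ ∈ Set.Ioc s t from ⟨h, h'⟩)]
    refine tendsto_const_nhds.congr' ?_
    filter_upwards [eventually_one_lt_mul (sub_pos.2 h)] with n hn
    rw [smoothStep_of_ge hn.le, smoothStep_of_le n h', sub_zero]
  · rw [Set.indicator_of_notMem fun h'' => absurd h''.2 (not_le.2 h')]
    refine tendsto_const_nhds.congr' ?_
    filter_upwards [eventually_one_lt_mul (sub_pos.2 h), eventually_one_lt_mul (sub_pos.2 h')]
      with n hn hn'
    rw [smoothStep_of_ge hn.le, smoothStep_of_ge hn'.le, sub_self]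

theorem IsTimeSobolev.intervalIntegrable_deriv {T : ℝ} {u u' : ℝ → X} (h : IsTimeSobolev T u u')
    {s t : ℝ} (hs : s ∈ Set.Icc 0 T) (ht : t ∈ Set.Icc 0 T) :
    IntervalIntegrable u' volume s t := by
  have h1 : IntervalIntegrable u' volume 0 T :=
    (intervalIntegrable_iff_integrableOn_Ioo_of_le (hs.1.trans hs.2)).2 h.integrableOn_deriv
  refine h1.mono_set ?_
  rw [Set.uIcc_of_le (hs.1.trans hs.2)]
  exact Set.uIcc_subset_Icc hs ht

variable [CompleteSpace X]

/-- The weak derivative is tested with a smoothed indicator of `(s, t]`, the difference of two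
steps. Its derivative concentrates at `s` and `t` with opposite signs and produces the point values;
the function itself tends to the indicator. -/
theorem IsTimeSobolev.sub_eq_integral_of_interior {T : ℝ} {u u' : ℝ → X}
    (h : IsTimeSobolev T u u') {s t : ℝ} (hs : 0 < s) (hst : s ≤ t) (ht : t < T) :
    u t - u s = ∫ τ in s..t, u' τ := by
  have hcont : ∀ r ∈ Set.Ioo 0 T, ContinuousAt u r := fun r hr =>
    h.1.continuousAt (Icc_mem_nhds hr.1 hr.2)
  have hs' : s ∈ Set.Ioo 0 T := ⟨hs, hst.trans_lt ht⟩
  have ht' : t ∈ Set.Ioo 0 T := ⟨hs.trans_le hst, ht⟩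
  have hdc : ∀ (r : ℝ) (n : ℕ), Continuous (deriv (smoothStep r n)) := fun r n =>
    (contDiff_smoothStep r n (k := 1)).continuous_deriv le_rfl
  have hdiff : ∀ (r : ℝ) (n : ℕ), Differentiable ℝ (smoothStep r n) := fun r n =>
    (contDiff_smoothStep r n (k := 1)).differentiable one_ne_zero
  have hint : ∀ (r : ℝ) (n : ℕ),
      IntegrableOn (fun τ => deriv (smoothStep r n) τ • u τ) (Set.Ioo 0 T) := fun r n => by
    obtain ⟨B, hB⟩ := isCompact_Icc.exists_bound_of_continuousOn
      (s := Set.Icc 0 T) (hdc r n).continuousOn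
    refine Integrable.bdd_smul (C := B) h.integrableOn (hdc r n).aestronglyMeasurable ?_
    exact ae_restrict_of_forall_mem measurableSet_Ioo fun x hx => hB x (Set.Ioo_subset_Icc_self hx)
  have h1 : Tendsto (fun n => ∫ τ in Set.Ioo 0 T,
      deriv (fun τ => smoothStep s n τ - smoothStep t n τ) τ • u τ) atTop (𝓝 (u s - u t)) := by
    refine ((tendsto_integral_deriv_smoothStep_smul hs' h.integrableOn (hcont s hs')).sub
      (tendsto_integral_deriv_smoothStep_smul ht' h.integrableOn (hcont t ht'))).congr fun n => ?_
    rw [← integral_sub (hint s n) (hint t n)]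
    congr 1
    ext τ
    rw [← sub_smul]
    congr 1
    exact (((hdiff s n τ).hasDerivAt.sub (hdiff t n τ).hasDerivAt).deriv).symm
  have h2 : Tendsto (fun n => ∫ τ in Set.Ioo 0 T, (smoothStep s n τ - smoothStep t n τ) • u' τ)
      atTop (𝓝 (∫ τ in Set.Ioo 0 T, (Set.Ioc s t).indicator (fun _ => (1 : ℝ)) τ • u' τ)) := by
    refine tendsto_integral_of_dominated_convergence (fun τ => ‖u' τ‖) (fun n => ?_)
      h.integrableOn_deriv.norm (fun n => Eventually.of_forall fun τ => ?_)
      (Eventually.of_forall fun τ => (tendsto_smoothStep_sub hst τ).smul_const _)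
    · exact ((hdiff s n).continuous.sub (hdiff t n).continuous).aestronglyMeasurable.smul
        h.integrableOn_deriv.1
    · rw [norm_smul]
      refine mul_le_of_le_one_left (norm_nonneg _) ?_
      rw [Real.norm_eq_abs, abs_le]
      have a1 : 0 ≤ smoothStep s n τ := Real.smoothTransition.nonneg _
      have a2 : smoothStep s n τ ≤ 1 := Real.smoothTransition.le_one _
      have a3 : 0 ≤ smoothStep t n τ := Real.smoothTransition.nonneg _
      have a4 : smoothStep t n τ ≤ 1 := Real.smoothTransition.le_one _
      constructor <;> linarith
  have h3 : u s - u t = - ∫ τ in Set.Ioo 0 T,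
      (Set.Ioc s t).indicator (fun _ => (1 : ℝ)) τ • u' τ := by
    refine tendsto_nhds_unique_of_eventuallyEq h1 h2.neg ?_
    filter_upwards [eventually_one_lt_mul (sub_pos.2 ht)] with n hn
    exact h.2.2.2 _ (isTestFunction_smoothStep_sub hs hst hn)
  have h4 : ∀ τ, (Set.Ioc s t).indicator (fun _ => (1 : ℝ)) τ • u' τ
      = (Set.Ioc s t).indicator u' τ := fun τ => by
    by_cases hτ : τ ∈ Set.Ioc s t <;> simp [hτ]
  have h5 : Set.Ioo 0 T ∩ Set.Ioc s t = Set.Ioc s t :=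
    Set.inter_eq_right.2 fun τ hτ => ⟨hs.trans hτ.1, hτ.2.trans_lt ht⟩
  simp only [h4] at h3
  rw [setIntegral_indicator measurableSet_Ioc, h5, ← intervalIntegral.integral_of_le hst] at h3
  rw [← neg_sub, h3, neg_neg]

/-- The fundamental theorem of calculus for Sobolev functions of time. -/
theorem IsTimeSobolev.sub_eq_integral {T : ℝ} {u u' : ℝ → X} (h : IsTimeSobolev T u u')
    {s t : ℝ} (hs : s ∈ Set.Icc 0 T) (ht : t ∈ Set.Icc 0 T) :
    u t - u s = ∫ τ in s..t, u' τ := by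
  rcases (hs.1.trans hs.2).eq_or_lt with hT | hT
  · subst hT
    rw [Set.Icc_self, Set.mem_singleton_iff] at hs ht
    simp [hs, ht]
  have h0 : (0 : ℝ) ∈ Set.Icc 0 T := ⟨le_rfl, hT.le⟩
  have hII : ∀ {s t : ℝ}, s ∈ Set.Icc 0 T → t ∈ Set.Icc 0 T → IntervalIntegrable u' volume s t :=
    fun hs ht => h.intervalIntegrable_deriv hs ht
  -- The identity is available only between interior times, so an interior base point is used; the
  -- endpoints follow because `u` minus its primitive is continuous on `[0, T]` and constant on the
  -- open interval.
  set m := T / 2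
  have hm : m ∈ Set.Ioo 0 T := ⟨half_pos hT, half_lt_self hT⟩
  have hm' := Set.Ioo_subset_Icc_self hm
  have hcI : ContinuousOn (fun t => ∫ τ in (0 : ℝ)..t, u' τ) (Set.Icc 0 T) := by
    have := intervalIntegral.continuousOn_primitive_interval (a := 0) (b := T) (μ := volume)
      (f := u') (by
        rw [Set.uIcc_of_le hT.le, integrableOn_Icc_iff_integrableOn_Ioo]
        exact h.integrableOn_deriv)
    rwa [Set.uIcc_of_le hT.le] at this
  have hEq : Set.EqOn (fun t => u t - ∫ τ in (0 : ℝ)..t, u' τ)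
      (fun _ => u m - ∫ τ in (0 : ℝ)..m, u' τ) (Set.Icc 0 T) := by
    refine Set.EqOn.of_subset_closure (s := Set.Ioo 0 T) (fun r hr => ?_) (h.1.sub hcI)
      continuousOn_const Set.Ioo_subset_Icc_self (by rw [closure_Ioo hT.ne])
    have hr' := Set.Ioo_subset_Icc_self hr
    have key : u r - u m = ∫ τ in m..r, u' τ := by
      rcases le_total m r with hmr | hmr
      · exact h.sub_eq_integral_of_interior hm.1 hmr hr.2
      · rw [intervalIntegral.integral_symm, ← h.sub_eq_integral_of_interior hr.1 hmr hm.2, neg_sub]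
    rw [← intervalIntegral.integral_interval_sub_left (hII h0 hr') (hII h0 hm')] at key
    rw [sub_eq_sub_iff_sub_eq_sub, key]
  have e1 := hEq hs
  have e2 := hEq ht
  rw [← intervalIntegral.integral_interval_sub_left (hII h0 ht) (hII h0 hs),
    ← sub_eq_sub_iff_sub_eq_sub]
  exact e2.trans e1.symm

/-- A Sobolev function of time is differentiable almost everywhere. -/
theorem IsTimeSobolev.ae_hasDerivAt {T : ℝ} {u u' : ℝ → X} (h : IsTimeSobolev T u u') :
    ∀ᵐ t ∂(volume.restrict (Set.Ioo 0 T)), HasDerivAt u (u' t) t := by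
  rw [ae_restrict_iff' measurableSet_Ioo]
  rcases le_or_gt T 0 with hT | hT
  · exact Eventually.of_forall fun t ht => absurd (ht.1.trans ht.2) (not_lt.2 hT)
  have h0 : (0 : ℝ) ∈ Set.Icc 0 T := ⟨le_rfl, hT.le⟩
  filter_upwards [(h.intervalIntegrable_deriv h0 ⟨hT.le, le_rfl⟩).ae_hasDerivAt_integral]
    with t ht htT
  rw [Set.uIcc_of_le hT.le] at ht
  have h1 := (ht (Set.Ioo_subset_Icc_self htT) 0 h0).const_add (u 0)
  refine h1.congr_of_eventuallyEq ?_
  filter_upwards [Icc_mem_nhds htT.1 htT.2] with s hs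
  rw [← h.sub_eq_integral h0 hs, add_sub_cancel]

/-- Lipschitz images of Sobolev functions of time are absolutely continuous. -/
theorem IsTimeSobolev.absolutelyContinuousOnInterval {T : ℝ} {u u' : ℝ → X}
    (h : IsTimeSobolev T u u') {Φ : X → ℝ} {C : ℝ} (hC : ∀ x y, |Φ x - Φ y| ≤ C * ‖x - y‖)
    {a b : ℝ} (ha : a ∈ Set.Icc 0 T) (hb : b ∈ Set.Icc 0 T) :
    AbsolutelyContinuousOnInterval (fun t => Φ (u t)) a b := by
  have hsub : Set.uIcc a b ⊆ Set.Icc 0 T := Set.uIcc_subset_Icc ha hb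
  have hII : ∀ {s t : ℝ}, s ∈ Set.Icc 0 T → t ∈ Set.Icc 0 T → IntervalIntegrable u' volume s t :=
    fun hs ht => h.intervalIntegrable_deriv hs ht
  -- Every increment of `Φ ∘ u` is bounded by the corresponding increment of this real primitive, so
  -- the same `δ` serves both.
  have hG : AbsolutelyContinuousOnInterval (fun t => |C| * ∫ τ in a..t, ‖u' τ‖) a b :=
    ((hII ha hb).norm.absolutelyContinuousOnInterval_intervalIntegral Set.left_mem_uIcc).const_mul
      |C|
  rw [absolutelyContinuousOnInterval_iff] at hG ⊢
  intro ε hε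
  obtain ⟨δ, hδ, H⟩ := hG ε hε
  refine ⟨δ, hδ, fun E hE hlt => lt_of_le_of_lt (Finset.sum_le_sum fun i hi => ?_) (H E hE hlt)⟩
  have hmem := hE.1 i hi
  have h1 := hsub hmem.1
  have h2 := hsub hmem.2
  rw [Real.dist_eq, Real.dist_eq, ← mul_sub, abs_mul, abs_abs,
    intervalIntegral.integral_interval_sub_left (hII ha h1).norm (hII ha h2).norm]
  refine (hC _ _).trans ?_
  rw [h.sub_eq_integral h2 h1]
  refine mul_le_mul (le_abs_self C) ?_ (norm_nonneg _) (abs_nonneg _)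
  exact intervalIntegral.norm_integral_le_abs_integral_norm

end TimeSobolev

/-- An absolutely continuous function with derivative at least `-c` decreases at most at
the rate `c`. -/
theorem _root_.AbsolutelyContinuousOnInterval.le_of_ae_le_deriv {f : ℝ → ℝ} {a b c : ℝ} (hab : a ≤ b)
    (hf : AbsolutelyContinuousOnInterval f a b)
    (hd : ∀ᵐ t ∂(volume.restrict (Set.Ioo a b)), ∃ f', HasDerivAt f f' t ∧ -c ≤ f') :
    f a ≤ f b + c * (b - a) := by
  have h1 : ∫ t in a..b, -c ≤ ∫ t in a..b, deriv f t := by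
    refine intervalIntegral.integral_mono_ae_restrict hab intervalIntegrable_const
      hf.intervalIntegrable_deriv ?_
    rw [← Measure.restrict_congr_set (Ioo_ae_eq_Icc (μ := volume) (a := a) (b := b))]
    filter_upwards [hd] with t ⟨f', h, hle⟩
    rwa [h.deriv]
  rw [hf.integral_deriv_eq_sub, intervalIntegral.integral_const, smul_eq_mul] at h1
  linarith

/-! ### Integral functionals on `L²` -/

section Nemytskii

variable {X : Type*} [MeasurableSpace X] {μ : Measure X} [IsFiniteMeasure μ]

theorem abs_sub_le_of_hasDerivAt {ψ ψ' : ℝ → ℝ} {C : ℝ} (hψ : ∀ s, HasDerivAt ψ (ψ' s) s)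
    (hC : ∀ s, |ψ' s| ≤ C) (r s : ℝ) : |ψ r - ψ s| ≤ C * |r - s| := by
  have := Convex.norm_image_sub_le_of_norm_hasDerivWithin_le (s := Set.univ) (f := ψ)
    (fun x _ => (hψ x).hasDerivWithinAt) (fun x _ => hC x) convex_univ
    (Set.mem_univ s) (Set.mem_univ r)
  simpa using this

/-- The mean value inequality for `ψ x - ψ' s * x` on the segment from `s` to `r`, where its
derivative is at most `K |r - s|`. -/
theorem abs_sub_sub_le_of_lipschitz_deriv {ψ ψ' : ℝ → ℝ} {K : ℝ} (hK0 : 0 ≤ K)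
    (hψ : ∀ s, HasDerivAt ψ (ψ' s) s)
    (hK : ∀ r s, |ψ' r - ψ' s| ≤ K * |r - s|) (r s : ℝ) :
    |ψ r - ψ s - ψ' s * (r - s)| ≤ K * (r - s) ^ 2 := by
  have h1 : ∀ x ∈ Set.uIcc s r, HasDerivWithinAt (fun x => ψ x - ψ' s * x) (ψ' x - ψ' s)
      (Set.uIcc s r) x := fun x _ => by
    have h := ((hψ x).sub ((hasDerivAt_id x).const_mul (ψ' s))).hasDerivWithinAt
      (s := Set.uIcc s r)
    rw [mul_one] at h
    exact h
  have h2 : ∀ x ∈ Set.uIcc s r, ‖ψ' x - ψ' s‖ ≤ K * |r - s| := fun x hx =>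
    (hK x s).trans (mul_le_mul_of_nonneg_left (Set.abs_sub_left_of_mem_uIcc hx) hK0)
  have := Convex.norm_image_sub_le_of_norm_hasDerivWithin_le h1 h2 (convex_uIcc s r)
    Set.left_mem_uIcc Set.right_mem_uIcc
  rw [Real.norm_eq_abs, Real.norm_eq_abs, mul_assoc, ← pow_two, sq_abs] at this
  convert this using 2
  ring

theorem integrable_comp_of_lipschitz {ψ : ℝ → ℝ} {C : ℝ} (hψ : Continuous ψ)
    (hC : ∀ r s, |ψ r - ψ s| ≤ C * |r - s|) (u : Lp ℝ 2 μ) :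
    Integrable (fun x => ψ (u x)) μ := by
  have hu : Integrable u μ := (Lp.memLp u).integrable (by norm_num)
  have h1 : Integrable (fun x => ψ (u x) - ψ 0) μ := by
    refine (hu.norm.const_mul C).mono' ((hψ.comp_aestronglyMeasurable hu.1).sub
      aestronglyMeasurable_const) (Eventually.of_forall fun x => ?_)
    simpa using hC (u x) 0
  refine (h1.add (integrable_const (ψ 0))).congr (Eventually.of_forall fun x => ?_)
  simp

/-- The integral functional with a `C^{1,1}` integrand is Fréchet differentiable on `L²`. -/
theorem hasFDerivAt_integral_comp {ψ ψ' : ℝ → ℝ} {C K : ℝ} (hK0 : 0 ≤ K)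
    (hψ : ∀ s, HasDerivAt ψ (ψ' s) s) (hC : ∀ s, |ψ' s| ≤ C)
    (hK : ∀ r s, |ψ' r - ψ' s| ≤ K * |r - s|) (u : Lp ℝ 2 μ) {p : Lp ℝ 2 μ}
    (hp : ∀ᵐ x ∂μ, p x = ψ' (u x)) :
    HasFDerivAt (fun v : Lp ℝ 2 μ => ∫ x, ψ (v x) ∂μ) (innerSL ℝ p) u := by
  have hc : Continuous ψ := continuous_iff_continuousAt.2 fun s => (hψ s).continuousAt
  have hLip := abs_sub_le_of_hasDerivAt hψ hC
  rw [hasFDerivAt_iff_isLittleO]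
  -- The global Lipschitz bound on `ψ'` makes the pointwise remainder quadratic in `v - u`, hence
  -- bounded after integration by the square of the `L²` norm. This gives Fréchet differentiability
  -- without integrability beyond `L²`.
  have hO : (fun v : Lp ℝ 2 μ => (∫ x, ψ (v x) ∂μ) - (∫ x, ψ (u x) ∂μ) - innerSL ℝ p (v - u))
      =O[𝓝 u] fun v => ‖v - u‖ ^ 2 := by
    refine Asymptotics.IsBigO.of_bound K (Eventually.of_forall fun v => ?_)
    have hi : Integrable (fun x => p x * (v - u) x) μ := by
      have := L2.integrable_inner (𝕜 := ℝ) (v - u) p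
      simpa [mul_comm] using this
    have hin : innerSL ℝ p (v - u) = ∫ x, p x * (v - u) x ∂μ := by
      rw [innerSL_apply_apply, L2.inner_def]
      simp [mul_comm]
    have hsq : ‖v - u‖ ^ 2 = ∫ x, ((v - u) x) ^ 2 ∂μ := by
      rw [← real_inner_self_eq_norm_sq, L2.inner_def]
      simp [pow_two]
    have hisq : Integrable (fun x => ((v - u) x) ^ 2) μ := (Lp.memLp (v - u)).integrable_sq
    have hid : Integrable (fun x => ψ (v x) - ψ (u x)) μ :=
      (integrable_comp_of_lipschitz hc hLip v).sub (integrable_comp_of_lipschitz hc hLip u)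
    rw [hin, ← integral_sub (integrable_comp_of_lipschitz hc hLip v)
      (integrable_comp_of_lipschitz hc hLip u), ← integral_sub
      hid hi,
      norm_pow, norm_norm, hsq, ← integral_const_mul]
    refine norm_integral_le_of_norm_le (hisq.const_mul K) ?_
    filter_upwards [hp, Lp.coeFn_sub v u] with x hx hx'
    rw [hx, hx', Pi.sub_apply]
    exact abs_sub_sub_le_of_lipschitz_deriv hK0 hψ hK _ _
  refine hO.trans_isLittleO ?_
  rw [Asymptotics.isLittleO_iff]
  intro c hc0
  filter_upwards [Metric.ball_mem_nhds u hc0] with v hv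
  rw [Metric.mem_ball, dist_eq_norm] at hv
  rw [norm_pow, norm_norm, pow_two]
  gcongr

theorem exists_Lp_comp {ψ' : ℝ → ℝ} {C : ℝ} (hψ' : Continuous ψ') (hC : ∀ s, |ψ' s| ≤ C)
    (u : Lp ℝ 2 μ) : ∃ p : Lp ℝ 2 μ, ∀ᵐ x ∂μ, p x = ψ' (u x) := by
  have h : MemLp (fun x => ψ' (u x)) 2 μ :=
    MemLp.of_bound (hψ'.comp_aestronglyMeasurable (Lp.memLp u).1) C
      (Eventually.of_forall fun x => hC _)
  exact ⟨h.toLp _, h.coeFn_toLp⟩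

/-- The integral functional with a `C^{1,1}` integrand of bounded derivative is Lipschitz. -/
theorem exists_lipschitz_integral_comp {ψ ψ' : ℝ → ℝ} {C K : ℝ} (hK0 : 0 ≤ K)
    (hψ : ∀ s, HasDerivAt ψ (ψ' s) s) (hψ' : Continuous ψ') (hC : ∀ s, |ψ' s| ≤ C)
    (hK : ∀ r s, |ψ' r - ψ' s| ≤ K * |r - s|) :
    ∃ B, ∀ u v : Lp ℝ 2 μ, |(∫ x, ψ (u x) ∂μ) - ∫ x, ψ (v x) ∂μ| ≤ B * ‖u - v‖ := by
  choose p hp using fun u : Lp ℝ 2 μ => exists_Lp_comp hψ' hC u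
  -- This bounds the `L²` norm of the gradient `ψ' ∘ u`: the pointwise bound `C` times the square
  -- root of the total mass.
  refine ⟨μ.real Set.univ ^ ((2 : ℝ≥0∞).toReal)⁻¹ * C, fun u v => ?_⟩
  refine Convex.norm_image_sub_le_of_norm_hasFDerivWithin_le (s := Set.univ)
    (f := fun v : Lp ℝ 2 μ => ∫ x, ψ (v x) ∂μ) (f' := fun u => innerSL ℝ (p u))
    (fun w _ => (hasFDerivAt_integral_comp hK0 hψ hC hK w (hp w)).hasFDerivWithinAt)
    (fun w _ => ?_) convex_univ (Set.mem_univ v) (Set.mem_univ u)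
  rw [innerSL_apply_norm]
  refine Lp.norm_le_of_ae_bound ((abs_nonneg _).trans (hC 0)) ?_
  filter_upwards [hp w] with x hx
  rw [hx]
  exact hC _

end Nemytskii

/-! ### The regularised logarithm and its companion test function -/

section Regularisation

/-- A smooth approximation of `-ln s`. -/
def regLog (b s : ℝ) : ℝ := -(1 / 2) * Real.log (s ^ 2 + b ^ 2)

/-- A smooth approximation of the identity that vanishes to third order at `0`. -/
def regId (b s : ℝ) : ℝ := s ^ 3 / (s ^ 2 + b ^ 2)

variable {b : ℝ}

theorem hasDerivAt_regLog (hb : 0 < b) (s : ℝ) :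
    HasDerivAt (regLog b) (-(s / (s ^ 2 + b ^ 2))) s := by
  have h : s ^ 2 + b ^ 2 ≠ 0 := by positivity
  have h1 : HasDerivAt (fun s : ℝ => s ^ 2 + b ^ 2) (2 * s) s := by
    simpa using ((hasDerivAt_id s).pow 2).add_const (b ^ 2)
  convert! (h1.log h).const_mul (-(1 / 2)) using 1
  field_simp

theorem continuous_deriv_regLog (hb : 0 < b) :
    Continuous fun s : ℝ => -(s / (s ^ 2 + b ^ 2)) := by
  refine (continuous_id.div (by fun_prop) fun s => ?_).neg
  positivity

theorem abs_deriv_regLog_le (hb : 0 < b) (s : ℝ) : |-(s / (s ^ 2 + b ^ 2))| ≤ 1 / b := by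
  have h : 0 < s ^ 2 + b ^ 2 := by positivity
  rw [abs_neg, abs_div, abs_of_pos h, div_le_div_iff₀ h hb, ← sq_abs s]
  nlinarith [sq_nonneg (|s| - b), abs_nonneg s]

/-- The difference factors as `(r - s)(rs - b²)` over the product of the denominators, and `|rs -
b²| ≤ r² + s² + b²`. -/
theorem abs_deriv_regLog_sub_le (hb : 0 < b) (r s : ℝ) :
    |-(r / (r ^ 2 + b ^ 2)) - -(s / (s ^ 2 + b ^ 2))| ≤ 1 / b ^ 2 * |r - s| := by
  have hr : 0 < r ^ 2 + b ^ 2 := by positivity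
  have hs : 0 < s ^ 2 + b ^ 2 := by positivity
  have h1 : -(r / (r ^ 2 + b ^ 2)) - -(s / (s ^ 2 + b ^ 2))
      = ((r * s - b ^ 2) / ((r ^ 2 + b ^ 2) * (s ^ 2 + b ^ 2))) * (r - s) := by
    field_simp
    ring
  rw [h1, abs_mul]
  refine mul_le_mul_of_nonneg_right ?_ (abs_nonneg _)
  rw [abs_div, abs_of_pos (mul_pos hr hs), div_le_div_iff₀ (mul_pos hr hs) (by positivity), one_mul]
  have h2 : |r * s - b ^ 2| ≤ (r ^ 2 + s ^ 2) + b ^ 2 := by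
    rw [abs_le]
    constructor <;> nlinarith [sq_nonneg (r - s), sq_nonneg (r + s)]
  calc |r * s - b ^ 2| * b ^ 2 ≤ ((r ^ 2 + s ^ 2) + b ^ 2) * b ^ 2 := by gcongr
    _ ≤ _ := by nlinarith [sq_nonneg (r * s)]

theorem hasDerivAt_regId (hb : 0 < b) (s : ℝ) :
    HasDerivAt (regId b) ((s ^ 4 + 3 * b ^ 2 * s ^ 2) / (s ^ 2 + b ^ 2) ^ 2) s := by
  have h : s ^ 2 + b ^ 2 ≠ 0 := by positivity
  have h1 : HasDerivAt (fun s : ℝ => s ^ 2 + b ^ 2) (2 * s) s := by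
    simpa using ((hasDerivAt_id s).pow 2).add_const (b ^ 2)
  have h2 : HasDerivAt (fun s : ℝ => s ^ 3) (3 * s ^ 2) s := by
    simpa using hasDerivAt_pow 3 s
  convert! h2.div h1 h using 1
  field_simp
  ring

theorem contDiff_regId (hb : 0 < b) : ContDiff ℝ 1 (regId b) := by
  refine ContDiff.div (by fun_prop) (by fun_prop) fun s => ?_
  positivity

theorem deriv_regId_nonneg (hb : 0 < b) (s : ℝ) : 0 ≤ deriv (regId b) s := by
  rw [(hasDerivAt_regId hb s).deriv]
  positivity

theorem abs_deriv_regId_le (hb : 0 < b) (s : ℝ) : |deriv (regId b) s| ≤ 3 := by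
  rw [abs_of_nonneg (deriv_regId_nonneg hb s), (hasDerivAt_regId hb s).deriv,
    div_le_iff₀ (by positivity)]
  nlinarith [sq_nonneg (s ^ 2), sq_nonneg (b ^ 2), sq_nonneg (b * s)]

theorem abs_regId_sub_le (hb : 0 < b) (s : ℝ) : |regId b s - s| ≤ b := by
  have h : 0 < s ^ 2 + b ^ 2 := by positivity
  have h1 : regId b s - s = -(s * b ^ 2) / (s ^ 2 + b ^ 2) := by
    rw [regId]
    field_simp
    ring
  rw [h1, abs_div, abs_neg, abs_mul, abs_of_pos h, div_le_iff₀ h, abs_of_pos (pow_pos hb 2),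
    ← sq_abs s]
  nlinarith [mul_nonneg hb.le (sq_nonneg (|s| - b)), mul_nonneg hb.le (abs_nonneg s),
    mul_nonneg (mul_nonneg hb.le hb.le) (abs_nonneg s), mul_nonneg hb.le (sq_nonneg b)]

/-- This identity dictates the choice of `regId`: testing `θ⁻² θ_t` with it yields minus the time
derivative of `regLog b θ`. -/
theorem one_div_sq_mul_regId {s : ℝ} (hs : s ≠ 0) :
    1 / s ^ 2 * regId b s = s / (s ^ 2 + b ^ 2) := by
  rw [regId]
  field_simp

theorem regLog_antitone {b c : ℝ} (hb : 0 < b) (hbc : b ≤ c) (s : ℝ) :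
    regLog c s ≤ regLog b s := by
  have : Real.log (s ^ 2 + b ^ 2) ≤ Real.log (s ^ 2 + c ^ 2) :=
    Real.log_le_log (by positivity) (by gcongr)
  rw [regLog, regLog]
  linarith

theorem tendsto_regLog_of_pos {s : ℝ} (hs : 0 < s) :
    Tendsto (fun b => regLog b s) (𝓝 0) (𝓝 (-Real.log s)) := by
  have h1 : ContinuousAt (fun b => regLog b s) 0 := by
    refine continuousAt_const.mul (ContinuousAt.log (by fun_prop) ?_)
    positivity
  have h2 : regLog 0 s = -Real.log s := by
    rw [regLog, zero_pow two_ne_zero, add_zero, Real.log_pow]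
    push_cast
    ring
  simpa [h2] using h1.tendsto

/-- Matches the convention that the entropy density is `+∞` at points with `θ = 0`. -/
theorem tendsto_regLog_zero : Tendsto (fun b => regLog b 0) (𝓝[>] 0) atTop := by
  have h : ∀ b, regLog b 0 = -Real.log b := fun b => by
    rw [regLog, zero_pow two_ne_zero, zero_add, Real.log_pow]
    push_cast
    ring
  simp only [h]
  exact tendsto_neg_atBot_atTop.comp Real.tendsto_log_nhdsGT_zero

end Regularisation

/-! ### Passage to the limit in extended integrals -/

/-- Monotone convergence for the extended integral. -/
theorem tendsto_coe_integral_extIntegral {X : Type*} [MeasurableSpace X] {μ : Measure X}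
    {F : ℕ → X → ℝ} {f : X → EReal} (hF : ∀ n, Integrable (F n) μ)
    (hmono : ∀ᵐ x ∂μ, Monotone fun n => F n x)
    (hlim : ∀ᵐ x ∂μ, Tendsto (fun n => (F n x : EReal)) atTop (𝓝 (f x))) :
    Tendsto (fun n => ((∫ x, F n x ∂μ : ℝ) : EReal)) atTop (𝓝 (extIntegral μ f)) := by
  have hpos : Tendsto (fun n => ∫⁻ x, ENNReal.ofReal (F n x) ∂μ) atTop
      (𝓝 (∫⁻ x, (f x).toENNReal ∂μ)) := by
    refine lintegral_tendsto_of_tendsto_of_monotone (fun n => (hF n).1.aemeasurable.ennreal_ofReal)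
      ?_ ?_
    · filter_upwards [hmono] with x hx m n hmn using ENNReal.ofReal_le_ofReal (hx hmn)
    · filter_upwards [hlim] with x hx
      have := (EReal.continuous_toENNReal.tendsto (f x)).comp hx
      simpa [Function.comp_def] using this
  have hneg : Tendsto (fun n => ∫⁻ x, ENNReal.ofReal (-F n x) ∂μ) atTop
      (𝓝 (∫⁻ x, (-f x).toENNReal ∂μ)) := by
    refine lintegral_tendsto_of_tendsto_of_antitone
      (fun n => (hF n).1.aemeasurable.neg.ennreal_ofReal) ?_ ?_ ?_
    · filter_upwards [hmono] with x hx m n hmn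
        using ENNReal.ofReal_le_ofReal (neg_le_neg (hx hmn))
    · have := (hF 0).neg.lintegral_lt_top.ne
      simpa using this
    · filter_upwards [hlim] with x hx
      have := (EReal.continuous_toENNReal.tendsto (-f x)).comp
        ((continuous_neg.tendsto (f x)).comp hx)
      simpa [Function.comp_def, ← EReal.coe_neg] using this
  -- The limit dominates the integrable function `F 0`, so its negative part has finite integral.
  -- This excludes `∞ - ∞` and makes the extended subtraction continuous at the limit.
  have hfin : ∫⁻ x, (-f x).toENNReal ∂μ ≠ ⊤ := by
    refine ne_top_of_le_ne_top (hF 0).neg.lintegral_lt_top.ne (lintegral_mono_ae ?_)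
    filter_upwards [hmono, hlim] with x hx hx'
    have h1 : (F 0 x : EReal) ≤ f x :=
      ge_of_tendsto' hx' fun n => EReal.coe_le_coe_iff.2 (hx (Nat.zero_le n))
    have h2 := EReal.toENNReal_le_toENNReal (EReal.neg_le_neg_iff.2 h1)
    rwa [← EReal.coe_neg, EReal.real_coe_toENNReal] at h2
  have heq : ∀ n, ((∫ x, F n x ∂μ : ℝ) : EReal)
      = ((∫⁻ x, ENNReal.ofReal (F n x) ∂μ : ℝ≥0∞) : EReal)
        + -((∫⁻ x, ENNReal.ofReal (-F n x) ∂μ : ℝ≥0∞) : EReal) := by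
    intro n
    rw [integral_eq_lintegral_pos_part_sub_lintegral_neg_part (hF n), EReal.coe_sub,
      EReal.coe_ennreal_toReal, EReal.coe_ennreal_toReal]
    · rfl
    · exact (hF n).neg.lintegral_lt_top.ne
    · exact (hF n).lintegral_lt_top.ne
  simp only [heq]
  rw [extIntegral, sub_eq_add_neg]
  refine (EReal.continuousAt_add (p := (_, _)) ?_ ?_).tendsto.comp
    (((continuous_coe_ennreal_ereal.tendsto _).comp hpos).prodMk_nhds
      ((continuous_neg.tendsto _).comp ((continuous_coe_ennreal_ereal.tendsto _).comp hneg)))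
  · right
    simpa using hfin
  · left
    exact EReal.coe_ennreal_ne_bot _

section

/-! ### Inner products and the Gibbs constraint in `L²`; closed conditions in time -/

section Lp

variable {X : Type*} [MeasurableSpace X] {μ : Measure X}

theorem integral_sum_mul_eq_sum_inner {ι F : Type*} [Fintype ι] [NormedAddCommGroup F]
    [InnerProductSpace ℝ F] (f g : ι → Lp F 2 μ) {h : ι → X → ℝ}
    (hh : ∀ i, ∀ᵐ x ∂μ, h i x = inner ℝ (f i x) (g i x)) :
    ∫ x, ∑ i, h i x ∂μ = ∑ i, inner ℝ (f i) (g i) := by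
  rw [integral_finsetSum]
  · refine Finset.sum_congr rfl fun i _ => ?_
    rw [L2.inner_def]
    exact integral_congr_ae (hh i)
  · intro i _
    refine (L2.integrable_inner (𝕜 := ℝ) (f i) (g i)).congr ?_
    filter_upwards [hh i] with x hx using hx.symm

theorem integral_sq_eq_norm_sq {F : Type*} [NormedAddCommGroup F] [InnerProductSpace ℝ F]
    (f : Lp F 2 μ) : ∫ x, ‖f x‖ ^ 2 ∂μ = ‖f‖ ^ 2 := by
  rw [← real_inner_self_eq_norm_sq, L2.inner_def]
  simp only [real_inner_self_eq_norm_sq]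

theorem coeFn_finset_sum {ι : Type*} (s : Finset ι) (u : ι → Lp ℝ 2 μ) :
    ∀ᵐ x ∂μ, (∑ i ∈ s, u i : Lp ℝ 2 μ) x = ∑ i ∈ s, u i x := by
  classical
  induction s using Finset.induction_on with
  | empty =>
    filter_upwards [Lp.coeFn_zero ℝ 2 μ] with x hx
    simpa using hx
  | insert i s hi ih =>
    rw [Finset.sum_insert hi]
    filter_upwards [ih, Lp.coeFn_add (u i) (∑ i ∈ s, u i)] with x hx hx'
    rw [hx', Pi.add_apply, hx, Finset.sum_insert hi]

variable [IsFiniteMeasure μ]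

/-- The constraint is the positive cone of the `L²` order intersected with the affine equation that
the components sum to the constant `1`; both are closed. It serves to extend the constraint from
almost every time to every time. -/
theorem isClosed_setOf_ae_mem_stdSimplex (M : ℕ) :
    IsClosed {u : Fin M → Lp ℝ 2 μ | ∀ᵐ x ∂μ, (fun α => u α x) ∈ stdSimplex ℝ (Fin M)} := by
  have h : {u : Fin M → Lp ℝ 2 μ | ∀ᵐ x ∂μ, (fun α => u α x) ∈ stdSimplex ℝ (Fin M)}
      = Set.Ici 0 ∩ {u | ∑ α, u α = Lp.const 2 μ (1 : ℝ)} := by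
    ext u
    simp only [stdSimplex, Set.mem_inter_iff, Set.mem_Ici, Pi.le_def, Pi.zero_apply,
      Set.mem_ofPred_eq, eventually_and, ae_all_iff]
    refine and_congr (forall_congr' fun α => ?_) ?_
    · rw [← Lp.coeFn_le]
      refine eventually_congr ?_
      filter_upwards [Lp.coeFn_zero ℝ 2 μ] with x hx
      rw [hx, Pi.zero_apply]
    · rw [Lp.ext_iff]
      refine eventually_congr ?_
      filter_upwards [coeFn_finset_sum Finset.univ u, Lp.coeFn_const (p := 2) (μ := μ) (1 : ℝ)]
        with x hx hx'
      rw [hx, hx', Function.const_apply]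
  rw [h]
  exact isClosed_Ici.inter (isClosed_eq (by fun_prop) continuous_const)

end Lp

/-- A closed condition that holds almost everywhere in time holds everywhere. -/
theorem forall_mem_Icc_of_ae_mem {X : Type*} [TopologicalSpace X] {T : ℝ} (hT : 0 < T)
    {u : ℝ → X} (hu : ContinuousOn u (Set.Icc 0 T)) {C : Set X} (hC : IsClosed C)
    (h : ∀ᵐ t ∂(volume.restrict (Set.Ioo 0 T)), u t ∈ C) : ∀ t ∈ Set.Icc 0 T, u t ∈ C := by
  intro t ht
  rw [ae_restrict_iff' measurableSet_Ioo] at h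
  -- A set of full Lebesgue measure is dense, so every time is a limit of times in `(0, T)` at which
  -- the condition holds.
  have h1 := (Measure.dense_of_ae h).open_subset_closure_inter (isOpen_Ioo (a := 0) (b := T))
  rw [← closure_Ioo hT.ne] at ht
  have h2 : t ∈ closure (Set.Ioo 0 T ∩ {t | t ∈ Set.Ioo 0 T → u t ∈ C}) :=
    closure_minimal h1 isClosed_closure ht
  rw [closure_Ioo hT.ne] at ht
  have h3 := ((hu t ht).mono (Set.inter_subset_left.trans Set.Ioo_subset_Icc_self)).mem_closure
    h2 (t := C) fun s hs => hs.2 hs.1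
  rwa [hC.closure_eq] at h3

variable {d M : ℕ} {Ω : Set (E d)}

/-- `toL2` as a continuous linear map. -/
def toL2L : H1 Ω →L[ℝ] L2 Ω := (WithLp.fstL 2 ℝ (L2 Ω) (L2Vec Ω)).comp (H1 Ω).subtypeL

/-- `grad` as a continuous linear map. -/
def gradL : H1 Ω →L[ℝ] L2Vec Ω := (WithLp.sndL 2 ℝ (L2 Ω) (L2Vec Ω)).comp (H1 Ω).subtypeL

/-! ### Explicit form of the entropy density -/

section EntropyDensity

theorem entropyDensity_of_pos (P : Parameters M) {θ : ℝ} (hθ : 0 < θ) (ϕ : Fin M → ℝ) :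
    entropyDensity P (energy P (temperature θ) ϕ) ϕ
      = ((-∑ α, P.Ltilde α * ϕ α + P.cv * -Real.log θ : ℝ) : EReal) := by
  have hcv := P.cv_pos
  have hT : ((temperature θ : ℝ≥0∞) : EReal) = ((θ⁻¹ : ℝ) : EReal) := by
    rw [temperature, ← ENNReal.ofReal_inv_of_pos hθ, EReal.coe_ennreal_ofReal,
      max_eq_left (inv_nonneg.2 hθ.le)]
  have hlog : ((energy P (temperature θ) ϕ + ((∑ α, P.L α * ϕ α : ℝ) : EReal))
      / (P.cv : EReal)).toENNReal = ENNReal.ofReal θ⁻¹ := by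
    rw [energy, hT, ← EReal.coe_mul, ← EReal.coe_add, ← EReal.coe_add, ← EReal.coe_div,
      EReal.real_coe_toENNReal]
    congr 1
    field_simp
    ring
  rw [entropyDensity, hlog, ENNReal.log_ofReal_of_pos (inv_pos.2 hθ), Real.log_inv,
    ← EReal.coe_mul, ← EReal.coe_add]

theorem entropyDensity_zero (P : Parameters M) (ϕ : Fin M → ℝ) :
    entropyDensity P (energy P (temperature 0) ϕ) ϕ = ⊤ := by
  have hcv := P.cv_pos
  rw [entropyDensity, energy, temperature, ENNReal.ofReal_zero, ENNReal.inv_zero,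
    EReal.coe_ennreal_top, EReal.coe_mul_top_of_pos hcv, EReal.coe_add_top, EReal.top_add_coe,
    EReal.top_div_of_pos_ne_top (EReal.coe_pos.2 hcv) (EReal.coe_ne_top _), EReal.toENNReal_top,
    ENNReal.log_top, EReal.coe_mul_top_of_pos hcv, EReal.coe_add_top]

theorem dotProduct_K_mulVec (ϕ : Fin M → ℝ) : ϕ ⬝ᵥ (K M).mulVec ϕ = -∑ α, ϕ α ^ 2 := by
  rw [K, Matrix.neg_mulVec, Matrix.one_mulVec, dotProduct_neg, dotProduct]
  simp only [pow_two]

end EntropyDensity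

/-! ### The regularised entropy and its limit -/

section RegularisedEntropy

variable [IsFiniteMeasure (volume.restrict Ω)]

/-- The part of the entropy that depends only on the phase field. -/
def phaseEntropy (P : Parameters M) (v : Fin M → H1 Ω) : ℝ :=
  ∑ α, (-(P.Ltilde α * inner ℝ (Lp.const 2 (volume.restrict Ω) (1 : ℝ)) (toL2 (v α)))
    - P.ε / 2 * ‖grad (v α)‖ ^ 2 + 1 / (2 * P.ε) * ‖toL2 (v α)‖ ^ 2)

/-- The entropy with `ln` replaced by a smooth approximation. -/
def regEntropy (P : Parameters M) (b : ℝ) (θ : L2 Ω) (v : Fin M → H1 Ω) : ℝ :=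
  phaseEntropy P v + P.cv * ∫ x in Ω, regLog b (θ x)

theorem integrable_regLog {b : ℝ} (hb : 0 < b) (θ : L2 Ω) :
    Integrable (fun x => regLog b (θ x)) (volume.restrict Ω) :=
  integrable_comp_of_lipschitz
    (continuous_iff_continuousAt.2 fun s => (hasDerivAt_regLog hb s).continuousAt)
    (abs_sub_le_of_hasDerivAt (hasDerivAt_regLog hb) (abs_deriv_regLog_le hb)) θ

/-- The integrand of `phaseEntropy`. -/
def phaseDensity (P : Parameters M) (v : Fin M → H1 Ω) (x : E d) : ℝ :=
  ∑ α, (-(P.Ltilde α * toL2 (v α) x) - P.ε / 2 * ‖grad (v α) x‖ ^ 2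
    + 1 / (2 * P.ε) * ‖toL2 (v α) x‖ ^ 2)

theorem integrable_phaseDensity_term (P : Parameters M) (v : Fin M → H1 Ω) (α : Fin M) :
    Integrable (fun x => -(P.Ltilde α * toL2 (v α) x) - P.ε / 2 * ‖grad (v α) x‖ ^ 2
      + 1 / (2 * P.ε) * ‖toL2 (v α) x‖ ^ 2) (volume.restrict Ω) :=
  (((((Lp.memLp (toL2 (v α))).integrable (by norm_num)).const_mul _).neg.sub
    ((Lp.memLp (grad (v α))).integrable_norm_pow (by norm_num) |>.const_mul _)).add
    ((Lp.memLp (toL2 (v α))).integrable_norm_pow (by norm_num) |>.const_mul _))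

theorem integrable_phaseDensity (P : Parameters M) (v : Fin M → H1 Ω) :
    Integrable (phaseDensity P v) (volume.restrict Ω) :=
  integrable_finsetSum _ fun α _ => integrable_phaseDensity_term P v α

theorem integral_phaseDensity (P : Parameters M) (v : Fin M → H1 Ω) :
    ∫ x in Ω, phaseDensity P v x = phaseEntropy P v := by
  unfold phaseDensity phaseEntropy
  rw [integral_finsetSum _ fun α _ => integrable_phaseDensity_term P v α]
  refine Finset.sum_congr rfl fun α _ => ?_
  have h1 : Integrable (fun x => -(P.Ltilde α * toL2 (v α) x)) (volume.restrict Ω) :=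
    (((Lp.memLp (toL2 (v α))).integrable (by norm_num)).const_mul _).neg
  have h2 : Integrable (fun x => P.ε / 2 * ‖grad (v α) x‖ ^ 2) (volume.restrict Ω) :=
    ((Lp.memLp (grad (v α))).integrable_norm_pow (by norm_num)).const_mul _
  have h3 : Integrable (fun x => 1 / (2 * P.ε) * ‖toL2 (v α) x‖ ^ 2) (volume.restrict Ω) :=
    ((Lp.memLp (toL2 (v α))).integrable_norm_pow (by norm_num)).const_mul _
  have h12 : Integrable (fun x => -(P.Ltilde α * toL2 (v α) x) - P.ε / 2 * ‖grad (v α) x‖ ^ 2)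
      (volume.restrict Ω) := h1.sub h2
  have h4 : ∫ x in Ω, toL2 (v α) x
      = inner ℝ (Lp.const 2 (volume.restrict Ω) (1 : ℝ)) (toL2 (v α)) := by
    rw [L2.inner_def]
    refine integral_congr_ae ?_
    filter_upwards [Lp.coeFn_const (p := 2) (μ := volume.restrict Ω) (1 : ℝ)] with x hx
    rw [hx]
    simp
  rw [integral_add h12 h3, integral_sub h1 h2, integral_neg, integral_const_mul,
    integral_const_mul, integral_const_mul, h4, integral_sq_eq_norm_sq, integral_sq_eq_norm_sq]

/-- The regularised entropies converge to the entropy. -/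
theorem tendsto_regEntropy (P : Parameters M) {θ : L2 Ω} (hθ : 0 ≤ θ) (v : Fin M → H1 Ω) :
    Tendsto (fun n : ℕ => ((regEntropy P (1 / ((n : ℝ) + 1)) θ v : ℝ) : EReal)) atTop
      (𝓝 (entropy₀ P (energyField P θ fun α => toL2 (v α)) v)) := by
  have hb : ∀ n : ℕ, 0 < 1 / ((n : ℝ) + 1) := fun n => by positivity
  have hcv := P.cv_pos
  have heq : ∀ n : ℕ, regEntropy P (1 / ((n : ℝ) + 1)) θ v
      = ∫ x in Ω, (phaseDensity P v x + P.cv * regLog (1 / ((n : ℝ) + 1)) (θ x)) := fun n => by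
    rw [integral_add (integrable_phaseDensity P v) ((integrable_regLog (hb n) θ).const_mul _),
      integral_phaseDensity, integral_const_mul, regEntropy]
  simp only [heq]
  refine tendsto_coe_integral_extIntegral
    (fun n => (integrable_phaseDensity P v).add ((integrable_regLog (hb n) θ).const_mul _))
    (Eventually.of_forall fun x m n hmn => ?_) ?_
  · have : regLog (1 / ((m : ℝ) + 1)) (θ x) ≤ regLog (1 / ((n : ℝ) + 1)) (θ x) :=
      regLog_antitone (hb n) (one_div_le_one_div_of_le (by positivity) (by gcongr)) _
    simp only
    gcongr
  · have hθ' : ∀ᵐ x ∂(volume.restrict Ω), 0 ≤ θ x := by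
      filter_upwards [(Lp.coeFn_le _ _).2 hθ, Lp.coeFn_zero ℝ 2 (volume.restrict Ω)] with x h1 h2
      rwa [h2] at h1
    filter_upwards [hθ'] with x hx
    have hq : phaseDensity P v x = (-∑ α, P.Ltilde α * toL2 (v α) x)
        - (P.ε / 2 * ∑ α, ‖grad (v α) x‖ ^ 2 + 1 / (2 * P.ε) *
            ((fun α => toL2 (v α) x) ⬝ᵥ (K M).mulVec (fun α => toL2 (v α) x))) := by
      rw [dotProduct_K_mulVec, phaseDensity, Finset.sum_add_distrib, Finset.sum_sub_distrib,
        Finset.sum_neg_distrib, ← Finset.mul_sum, ← Finset.mul_sum]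
      simp only [Real.norm_eq_abs, sq_abs]
      ring
    -- At points with `θ = 0` both sides are driven to `+∞` by the logarithm; where `θ > 0`
    -- everything is finite and converges in `ℝ`.
    rcases hx.eq_or_lt with h0 | h0
    · rw [energyField, ← h0, entropyDensity_zero, EReal.top_sub_coe]
      refine EReal.tendsto_coe_nhds_top_iff.2 ?_
      refine tendsto_atTop_add_const_left _ _ (Tendsto.const_mul_atTop hcv ?_)
      exact tendsto_regLog_zero.comp (tendsto_nhdsWithin_iff.2
        ⟨tendsto_one_div_add_atTop_nhds_zero_nat, Eventually.of_forall fun n => hb n⟩)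
    · rw [energyField, entropyDensity_of_pos P h0, ← EReal.coe_sub]
      refine (continuous_coe_real_ereal.tendsto _).comp ?_
      have := (((tendsto_regLog_of_pos h0).comp tendsto_one_div_add_atTop_nhds_zero_nat).const_mul
        P.cv).const_add (phaseDensity P v x)
      rw [show -∑ α, P.Ltilde α * toL2 (v α) x + P.cv * -Real.log (θ x)
          - (P.ε / 2 * ∑ α, ‖grad (v α) x‖ ^ 2 + 1 / (2 * P.ε) *
            ((fun α => toL2 (v α) x) ⬝ᵥ (K M).mulVec (fun α => toL2 (v α) x)))
          = phaseDensity P v x + P.cv * -Real.log (θ x) by rw [hq]; ring]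
      exact this

end RegularisedEntropy

end

/-! ### Variational equality and the lower bound for the entropy rate -/

section

variable {d M : ℕ} {Ω : Set (E d)}

section Chi

variable {X : Type*} {A : Set X} {v u : X} {r : ℝ}

/-- Subtracting `⊤` in `EReal` always gives `⊥`, even from `⊤`, so the inequality for any single
competitor `v` already forces the constraint. -/
theorem mem_of_nonneg_add_chi_sub (h : 0 ≤ (r : EReal) + chi A v - chi A u) : u ∈ A := by
  by_contra hu
  rw [show chi A u = ⊤ from if_neg hu, EReal.sub_top, le_bot_iff] at h
  exact EReal.zero_ne_bot h

theorem nonneg_of_nonneg_add_chi_sub (hv : v ∈ A) (hu : u ∈ A)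
    (h : 0 ≤ (r : EReal) + chi A v - chi A u) : 0 ≤ r := by
  rw [show chi A u = 0 from if_pos hu, show chi A v = 0 from if_pos hv, add_zero, sub_zero] at h
  exact_mod_cast h

end Chi

theorem hasDerivAt_toL2 {u : ℝ → Fin M → H1 Ω} {t : ℝ} {D : Fin M → H1 Ω}
    (hD : HasDerivAt u D t) (α : Fin M) :
    HasDerivAt (fun s => toL2 (u s α)) (toL2 (D α)) t :=
  (toL2L (Ω := Ω)).hasFDerivAt.comp_hasDerivAt t (hasDerivAt_pi.1 hD α)

theorem hasDerivAt_grad {u : ℝ → Fin M → H1 Ω} {t : ℝ} {D : Fin M → H1 Ω}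
    (hD : HasDerivAt u D t) (α : Fin M) :
    HasDerivAt (fun s => grad (u s α)) (grad (D α)) t :=
  (gradL (Ω := Ω)).hasFDerivAt.comp_hasDerivAt t (hasDerivAt_pi.1 hD α)

/-- Along a differentiable curve in the constraint set, the variational inequality becomes an
equality in the direction of the velocity. -/
theorem variational_eq_of_hasDerivAt {P : Parameters M} {A : Fin M → L2 Ω}
    {u : ℝ → Fin M → H1 Ω} {t : ℝ} {D : Fin M → H1 Ω} (hD : HasDerivAt u D t)
    (hG : ∀ᶠ s in 𝓝 t, u s ∈ gibbsSet Ω M)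
    (hVI : ∀ v ∈ gibbsSet Ω M, 0 ≤ ∑ α, inner ℝ (A α) (toL2 (v α) - toL2 (u t α))
      + P.ε * ∑ α, inner ℝ (grad (u t α)) (grad (v α) - grad (u t α))) :
    ∑ α, inner ℝ (A α) (toL2 (D α)) + P.ε * ∑ α, inner ℝ (grad (u t α)) (grad (D α)) = 0 := by
  -- The competitor `u s` makes the expression nonnegative for `s` near `t` on both sides, and it
  -- vanishes at `s = t`; the derivative at this minimum is the asserted sum.
  have hmin : IsLocalMin (fun s => ∑ α, inner ℝ (A α) (toL2 (u s α) - toL2 (u t α))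
      + P.ε * ∑ α, inner ℝ (grad (u t α)) (grad (u s α) - grad (u t α))) t := by
    filter_upwards [hG] with s hs
    simpa using hVI _ hs
  refine hmin.hasDerivAt_eq_zero ?_
  refine (HasDerivAt.fun_sum fun α _ => ?_).add ((HasDerivAt.fun_sum fun α _ => ?_).const_mul _)
  · exact (innerSL ℝ (A α)).hasFDerivAt.comp_hasDerivAt t ((hasDerivAt_toL2 hD α).sub_const _)
  · exact (innerSL ℝ (grad (u t α))).hasFDerivAt.comp_hasDerivAt t
      ((hasDerivAt_grad hD α).sub_const _)

variable [IsFiniteMeasure (volume.restrict Ω)]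

/-- The zeroth order part of the phase field equation. -/
def phaseForce (P : Parameters M) (φt φ : Fin M → L2 Ω) (θ : L2 Ω) (α : Fin M) : L2 Ω :=
  (P.ε * P.β) • φt α + P.Ltilde α • Lp.const 2 (volume.restrict Ω) (1 : ℝ)
    - P.L α • θ - (1 / P.ε) • φ α

theorem integral_variational_eq (P : Parameters M) (φt φ : Fin M → L2 Ω) (θ : L2 Ω)
    (u v : Fin M → H1 Ω) :
    (∫ x in Ω, ∑ α, (P.ε * P.β * φt α x + P.Ltilde α - θ x * P.L α
        + 1 / P.ε * (K M).mulVec (fun γ => φ γ x) α) * (toL2 (v α) x - φ α x))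
      + P.ε * ∫ x in Ω, ∑ α, inner ℝ (grad (u α) x) (grad (v α) x - grad (u α) x)
    = ∑ α, inner ℝ (phaseForce P φt φ θ α) (toL2 (v α) - φ α)
      + P.ε * ∑ α, inner ℝ (grad (u α)) (grad (v α) - grad (u α)) := by
  congr 1
  · refine integral_sum_mul_eq_sum_inner _ _ fun α => ?_
    filter_upwards [Lp.coeFn_sub (toL2 (v α)) (φ α),
      Lp.coeFn_sub ((P.ε * P.β) • φt α + P.Ltilde α • Lp.const 2 (volume.restrict Ω) (1 : ℝ)
        - P.L α • θ) ((1 / P.ε) • φ α),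
      Lp.coeFn_sub ((P.ε * P.β) • φt α + P.Ltilde α • Lp.const 2 (volume.restrict Ω) (1 : ℝ))
        (P.L α • θ),
      Lp.coeFn_add ((P.ε * P.β) • φt α) (P.Ltilde α • Lp.const 2 (volume.restrict Ω) (1 : ℝ)),
      Lp.coeFn_smul (P.ε * P.β) (φt α),
      Lp.coeFn_smul (P.Ltilde α) (Lp.const 2 (volume.restrict Ω) (1 : ℝ)),
      Lp.coeFn_smul (P.L α) θ, Lp.coeFn_smul (1 / P.ε) (φ α),
      Lp.coeFn_const (p := 2) (μ := volume.restrict Ω) (1 : ℝ)]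
      with x h1 h2 h3 h4 h5 h6 h7 h8 h9
    rw [h1, phaseForce, h2, Pi.sub_apply, h3, Pi.sub_apply, h4, Pi.add_apply, h5, h6, h7, h8,
      Pi.smul_apply, Pi.smul_apply, Pi.smul_apply, Pi.smul_apply, h9, K, Matrix.neg_mulVec,
      Matrix.one_mulVec]
    simp only [smul_eq_mul, Function.const_apply, Pi.sub_apply, Pi.neg_apply, inner]
    simp
    ring
  · congr 1
    refine integral_sum_mul_eq_sum_inner _ _ fun α => ?_
    filter_upwards [Lp.coeFn_sub (grad (v α)) (grad (u α))] with x hx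
    rw [hx, Pi.sub_apply]

theorem hasDerivAt_phaseEntropy (P : Parameters M) {u : ℝ → Fin M → H1 Ω} {t : ℝ}
    {D : Fin M → H1 Ω} (hD : HasDerivAt u D t) :
    HasDerivAt (fun s => phaseEntropy P (u s))
      (∑ α, (-(P.Ltilde α * inner ℝ (Lp.const 2 (volume.restrict Ω) (1 : ℝ)) (toL2 (D α)))
        - P.ε * inner ℝ (grad (u t α)) (grad (D α))
        + 1 / P.ε * inner ℝ (toL2 (u t α)) (toL2 (D α)))) t := by
  have hε := P.ε_pos
  refine HasDerivAt.fun_sum fun α _ => ?_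
  have h1 := ((innerSL ℝ (Lp.const 2 (volume.restrict Ω) (1 : ℝ))).hasFDerivAt.comp_hasDerivAt t
    (hasDerivAt_toL2 hD α)).const_mul (P.Ltilde α)
  have h2 := ((hasDerivAt_grad hD α).norm_sq).const_mul (P.ε / 2)
  have h3 := ((hasDerivAt_toL2 hD α).norm_sq).const_mul (1 / (2 * P.ε))
  refine ((h1.neg.sub h2).add h3).congr_deriv ?_
  simp only [innerSL_apply_apply]
  field_simp

theorem contDiff_phaseEntropy (P : Parameters M) :
    ContDiff ℝ 1 (phaseEntropy P : (Fin M → H1 Ω) → ℝ) := by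
  have h1 : ∀ α, ContDiff ℝ 1 fun v : Fin M → H1 Ω => toL2 (v α) := fun α =>
    (toL2L (Ω := Ω)).contDiff.comp (contDiff_apply ℝ (H1 Ω) α)
  have h2 : ∀ α, ContDiff ℝ 1 fun v : Fin M → H1 Ω => grad (v α) := fun α =>
    (gradL (Ω := Ω)).contDiff.comp (contDiff_apply ℝ (H1 Ω) α)
  refine ContDiff.sum fun α _ => ?_
  exact ((contDiff_const.mul (contDiff_const.inner ℝ (h1 α))).neg.sub
    (contDiff_const.mul ((h2 α).norm_sq ℝ))).add (contDiff_const.mul ((h1 α).norm_sq ℝ))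

/-- The energy balance tested with a regularisation of `θ`. -/
theorem exists_le_of_energy_balance (hΩ : IsOpen Ω) (P : Parameters M) {φt : Fin M → L2 Ω}
    {θt : L2 Ω} {θ : H1 Ω} (hpos : ∀ᵐ x ∂(volume.restrict Ω), 0 < toL2 θ x)
    (hE : ∀ w : H1 Ω, (∫ x in Ω, (-(∑ α, P.L α * φt α x)
        - P.cv * (1 / (toL2 θ x) ^ 2 * θt x)) * toL2 w x)
      - P.κ * ∫ x in Ω, inner ℝ (grad θ x) (grad w x) = 0)
    {b : ℝ} (hb : 0 < b) {p : L2 Ω}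
    (hp : ∀ᵐ x ∂(volume.restrict Ω), p x = -(toL2 θ x / (toL2 θ x ^ 2 + b ^ 2))) :
    ∃ w : L2 Ω, (∀ᵐ x ∂(volume.restrict Ω), w x = regId b (toL2 θ x)) ∧
      ∑ α, P.L α * inner ℝ (φt α) w ≤ P.cv * inner ℝ p θt := by
  obtain ⟨w, hw, hgw⟩ := exists_H1_comp hΩ θ (contDiff_regId hb) (abs_deriv_regId_le hb)
  refine ⟨toL2 w, hw, ?_⟩
  -- Since `regId b` is nondecreasing, the diffusion term is nonnegative; discarding it turns the
  -- energy balance into an inequality.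
  have hgrad : 0 ≤ ∫ x in Ω, inner ℝ (grad θ x) (grad w x) := by
    refine integral_nonneg_of_ae ?_
    filter_upwards [hgw] with x hx
    rw [hx, real_inner_smul_right, Pi.zero_apply]
    exact mul_nonneg (deriv_regId_nonneg hb _) real_inner_self_nonneg
  have hsplit : ∫ x in Ω, (-(∑ α, P.L α * φt α x)
        - P.cv * (1 / (toL2 θ x) ^ 2 * θt x)) * toL2 w x
      = -(∑ α, P.L α * inner ℝ (φt α) (toL2 w)) + P.cv * inner ℝ p θt := by
    have h1 : ∀ α, Integrable (fun x => P.L α * inner ℝ (φt α x) (toL2 w x))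
        (volume.restrict Ω) := fun α => (L2.integrable_inner (𝕜 := ℝ) _ _).const_mul _
    have h2 : Integrable (fun x => P.cv * inner ℝ (p x) (θt x)) (volume.restrict Ω) :=
      (L2.integrable_inner (𝕜 := ℝ) _ _).const_mul _
    have h3 : Integrable (fun x => -∑ α, P.L α * inner ℝ (φt α x) (toL2 w x))
        (volume.restrict Ω) := (integrable_finsetSum _ fun α _ => h1 α).neg
    calc _ = ∫ x in Ω, (-(∑ α, P.L α * inner ℝ (φt α x) (toL2 w x))
          + P.cv * inner ℝ (p x) (θt x)) := by
          refine integral_congr_ae ?_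
          filter_upwards [hw, hp, hpos] with x hx hpx hx0
          have h4 := one_div_sq_mul_regId (b := b) hx0.ne'
          have h5 : ∑ α, P.L α * inner ℝ (φt α x) (toL2 w x)
              = (∑ α, P.L α * φt α x) * toL2 w x := by
            rw [Finset.sum_mul]
            refine Finset.sum_congr rfl fun α _ => ?_
            simp only [inner]
            simp
            ring
          have h6 : inner ℝ (p x) (θt x) = p x * θt x := by
            simp [inner, mul_comm]
          rw [h5, h6, hpx, ← h4, hx]
          ring
      _ = _ := by
          rw [integral_add h3 h2, integral_neg, integral_finsetSum _ fun α _ => h1 α,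
            integral_const_mul]
          simp only [integral_const_mul, L2.inner_def]
  have h := hE w
  rw [hsplit] at h
  have := mul_nonneg P.κ_pos.le hgrad
  linarith

/-- The rate of change of the regularised entropy is bounded below. -/
theorem exists_entropy_rate_bound (hΩ : IsOpen Ω) (P : Parameters M) :
    ∃ C : ℝ, ∀ {b : ℝ}, 0 < b → ∀ {φt : Fin M → L2 Ω} {θt : L2 Ω} {θ : H1 Ω}
      {u D : Fin M → H1 Ω},
      (∀ᵐ x ∂(volume.restrict Ω), 0 < toL2 θ x) →
      (∀ w : H1 Ω, (∫ x in Ω, (-(∑ α, P.L α * φt α x)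
          - P.cv * (1 / (toL2 θ x) ^ 2 * θt x)) * toL2 w x)
        - P.κ * ∫ x in Ω, inner ℝ (grad θ x) (grad w x) = 0) →
      (∀ α, toL2 (D α) = φt α) →
      (∑ α, inner ℝ (phaseForce P φt (fun α => toL2 (u α)) (toL2 θ) α) (toL2 (D α))
        + P.ε * ∑ α, inner ℝ (grad (u α)) (grad (D α)) = 0) →
      ∀ {p : L2 Ω},
      (∀ᵐ x ∂(volume.restrict Ω), p x = -(toL2 θ x / (toL2 θ x ^ 2 + b ^ 2))) →
      -(C * b ^ 2) ≤
        (∑ α, (-(P.Ltilde α * inner ℝ (Lp.const 2 (volume.restrict Ω) (1 : ℝ)) (toL2 (D α)))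
          - P.ε * inner ℝ (grad (u α)) (grad (D α))
          + 1 / P.ε * inner ℝ (toL2 (u α)) (toL2 (D α)))) + P.cv * inner ℝ p θt := by
  set m : ℝ := (volume.restrict Ω).real Set.univ ^ ((2 : ℝ≥0∞).toReal)⁻¹
  have hk : 0 < P.ε * P.β := mul_pos P.ε_pos P.β_pos
  -- The constant comes from completing the square in `‖φ_t‖`: the minimum of `εβ x² - L_α m b x` is
  -- `-(L_α m)² b² / (4εβ)`.
  refine ⟨∑ α, (P.L α * m) ^ 2 / (4 * (P.ε * P.β)), ?_⟩
  intro b hb φt θt θ u D hpos hE hD hvar p hp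
  obtain ⟨w, hw, hle⟩ := exists_le_of_energy_balance hΩ P hpos hE hb hp
  have hnorm : ‖w - toL2 θ‖ ≤ m * b := by
    refine Lp.norm_le_of_ae_bound hb.le ?_
    filter_upwards [hw, Lp.coeFn_sub w (toL2 θ)] with x hx hx'
    rw [hx', Pi.sub_apply, hx]
    exact abs_regId_sub_le hb _
  -- Subtracting the variational equality cancels the `L̃`, gradient and `1/ε` terms, leaving the
  -- dissipation and the coupling to `θ`.
  have hphase : (∑ α, (-(P.Ltilde α * inner ℝ (Lp.const 2 (volume.restrict Ω) (1 : ℝ))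
        (toL2 (D α))) - P.ε * inner ℝ (grad (u α)) (grad (D α))
        + 1 / P.ε * inner ℝ (toL2 (u α)) (toL2 (D α))))
      = ∑ α, (P.ε * P.β * ‖φt α‖ ^ 2 - P.L α * inner ℝ (φt α) (toL2 θ)) := by
    rw [Finset.mul_sum, ← Finset.sum_add_distrib] at hvar
    rw [← sub_eq_zero, ← Finset.sum_sub_distrib, ← neg_eq_zero, ← Finset.sum_neg_distrib, ← hvar]
    refine Finset.sum_congr rfl fun α _ => ?_
    rw [phaseForce, inner_sub_left, inner_sub_left, inner_add_left, real_inner_smul_left,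
      real_inner_smul_left, real_inner_smul_left, real_inner_smul_left, hD,
      real_inner_self_eq_norm_sq, real_inner_comm (φt α) (toL2 θ)]
    ring
  rw [hphase]
  refine le_trans ?_ (add_le_add_right hle _)
  rw [Finset.sum_mul, ← Finset.sum_neg_distrib, ← Finset.sum_add_distrib]
  refine Finset.sum_le_sum fun α _ => ?_
  have h1 : -(‖φt α‖ * (m * b)) ≤ inner ℝ (φt α) (w - toL2 θ) := by
    have h2 := (abs_le.1 (abs_real_inner_le_norm (φt α) (w - toL2 θ))).1
    have h3 := mul_le_mul_of_nonneg_left hnorm (norm_nonneg (φt α))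
    linarith
  rw [inner_sub_right] at h1
  have h4 := mul_le_mul_of_nonneg_left h1 (P.L_nonneg α)
  have h5 : -((P.L α * m) ^ 2 / (4 * (P.ε * P.β)) * b ^ 2)
      ≤ P.ε * P.β * ‖φt α‖ ^ 2 - P.L α * (‖φt α‖ * (m * b)) := by
    rw [neg_le_iff_add_nonneg]
    have : P.ε * P.β * ‖φt α‖ ^ 2 - P.L α * (‖φt α‖ * (m * b))
        + (P.L α * m) ^ 2 / (4 * (P.ε * P.β)) * b ^ 2
        = (2 * (P.ε * P.β) * ‖φt α‖ - P.L α * m * b) ^ 2 / (4 * (P.ε * P.β)) := by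
      generalize P.ε * P.β = k at hk
      field_simp
      ring
    rw [this]
    positivity
  linarith

end

/-! ### The regularised entropy inequality and the limit `b → 0` -/

/-- The entropy inequality for the regularised entropies, with an error that vanishes with
the regularisation parameter. -/
theorem exists_regEntropy_le {d M : ℕ} {Ω : Set (E d)} [IsFiniteMeasure (volume.restrict Ω)]
    (hΩ : IsOpen Ω) {P : Parameters M} {t₀ tstar : ℝ} (ht₀ : 0 < t₀)
    {φ0 : Fin M → L2 Ω} {θ0 : L2 Ω} {φ : ℝ → Fin M → L2 Ω} {θ : ℝ → L2 Ω}
    (hsol : IsSolution P tstar φ0 θ0 φ θ) {φC : ℝ → Fin M → H1 Ω}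
    (hφC : ContDiffOn ℝ 1 φC (Set.Icc t₀ tstar))
    (hφ : ∀ t ∈ Set.Icc t₀ tstar, ∀ α, toL2 (φC t α) = φ t α)
    (hG : ∀ t ∈ Set.Icc t₀ tstar, φC t ∈ gibbsSet Ω M)
    {t₁ t₂ : ℝ} (ht₁ : t₁ ∈ Set.Icc t₀ tstar) (ht₂ : t₂ ∈ Set.Icc t₀ tstar) (h12 : t₁ ≤ t₂) :
    ∃ C : ℝ, ∀ b : ℝ, 0 < b →
      regEntropy P b (θ t₁) (φC t₁) ≤ regEntropy P b (θ t₂) (φC t₂) + C * b ^ 2 * (t₂ - t₁) := by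
  obtain ⟨φt, θt, φH, θH, hφS, hθS, -, -, hH, hpos, -, -, hVI, hE⟩ := hsol
  obtain ⟨C, hC⟩ := exists_entropy_rate_bound hΩ P
  refine ⟨C, fun b hb => ?_⟩
  have hsub : Set.Icc t₁ t₂ ⊆ Set.Icc t₀ tstar := Set.Icc_subset_Icc ht₁.1 ht₂.2
  have hsub0 : Set.Icc t₀ tstar ⊆ Set.Icc 0 tstar := Set.Icc_subset_Icc_left ht₀.le
  have hsubo : Set.Ioo t₁ t₂ ⊆ Set.Ioo 0 tstar :=
    Set.Ioo_subset_Ioo (ht₀.le.trans ht₁.1) ht₂.2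
  have hb2 : (0 : ℝ) ≤ 1 / b ^ 2 := by positivity
  obtain ⟨B, hB⟩ := exists_lipschitz_integral_comp (μ := volume.restrict Ω) hb2
    (hasDerivAt_regLog hb) (continuous_deriv_regLog hb) (abs_deriv_regLog_le hb)
    (abs_deriv_regLog_sub_le hb)
  -- The phase part is `C¹` in time as a smooth function of an `H¹`-valued `C¹` curve; the
  -- logarithmic part is a Lipschitz functional of `θ ∈ H¹(0,T;L²)`.
  have hAC : AbsolutelyContinuousOnInterval (fun t => regEntropy P b (θ t) (φC t)) t₁ t₂ := by
    refine AbsolutelyContinuousOnInterval.add ?_ (AbsolutelyContinuousOnInterval.const_mul _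
      (hθS.absolutelyContinuousOnInterval hB (hsub0 ht₁) (hsub0 ht₂)))
    refine ContDiffOn.absolutelyContinuousOnInterval ?_
    rw [Set.uIcc_of_le h12]
    exact (contDiff_phaseEntropy P).comp_contDiffOn (hφC.mono hsub)
  refine AbsolutelyContinuousOnInterval.le_of_ae_le_deriv h12 hAC ?_
  have hmem : ∀ᵐ t ∂(volume.restrict (Set.Ioo t₁ t₂)), t ∈ Set.Ioo t₁ t₂ :=
    ae_restrict_mem measurableSet_Ioo
  have hmono := fun {p : ℝ → Prop} (h : ∀ᵐ t ∂(volume.restrict (Set.Ioo 0 tstar)), p t) =>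
    ae_restrict_of_ae_restrict_of_subset hsubo h
  filter_upwards [hmem, hmono hH, hmono hpos, hmono hVI, hmono hE, hmono hφS.ae_hasDerivAt,
    hmono hθS.ae_hasDerivAt] with t ht hHt hpost hVIt hEt hφt hθt
  have htI := hsub (Set.Ioo_subset_Icc_self ht)
  have hnhds : Set.Icc t₀ tstar ∈ 𝓝 t :=
    mem_of_superset (Icc_mem_nhds ht.1 ht.2) hsub
  obtain ⟨hφHt, hθHt⟩ := hHt
  -- The solution's `H¹` lift and the `C¹` lift share the same `L²` function, so uniqueness of the
  -- weak gradient identifies them.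
  have hφHC : φH t = φC t := by
    ext1 α
    exact toL2_injective hΩ ((hφHt α).trans (hφ t htI α).symm)
  have hφtC : φ t = fun α => toL2 (φC t α) := funext fun α => (hφ t htI α).symm
  have hD : HasDerivAt φC (deriv φC t) t :=
    ((hφC.contDiffAt hnhds).differentiableAt one_ne_zero).hasDerivAt
  have hDt : ∀ α, toL2 (deriv φC t α) = φt t α := fun α => by
    refine (hasDerivAt_toL2 hD α).unique ((hasDerivAt_pi.1 hφt α).congr_of_eventuallyEq ?_)
    filter_upwards [hnhds] with s hs using hφ s hs α
  have hvar := variational_eq_of_hasDerivAt (P := P)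
    (A := phaseForce P (φt t) (fun α => toL2 (φC t α)) (toL2 (θH t))) hD
    (by filter_upwards [hnhds] with s hs using hG s hs) (fun v hv => by
      have h1 := hVIt v
      rw [hφHC] at h1
      have h2 := nonneg_of_nonneg_add_chi_sub hv (hG t htI) h1
      rw [hφtC, ← hθHt] at h2
      rwa [integral_variational_eq] at h2)
  rw [← hθHt] at hpost hEt
  obtain ⟨p, hp⟩ := exists_Lp_comp (μ := volume.restrict Ω) (continuous_deriv_regLog hb)
    (abs_deriv_regLog_le hb) (θ t)
  have hderiv : HasDerivAt (fun t => regEntropy P b (θ t) (φC t)) _ t :=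
    (hasDerivAt_phaseEntropy P hD).add
      (((hasFDerivAt_integral_comp hb2 (hasDerivAt_regLog hb) (abs_deriv_regLog_le hb)
        (abs_deriv_regLog_sub_le hb) (θ t) hp).comp_hasDerivAt t hθt).const_mul P.cv)
  rw [← hθHt] at hp
  exact ⟨_, hderiv, hC hb hpost (fun w => (hEt w).2) hDt hvar hp⟩

/-- Thermodynamic consistency: the entropy of a solution is non-decreasing. -/
theorem monotoneOn_entropy {d M : ℕ} {Ω : Set (E d)}
    (hΩ_open : IsOpen Ω) (hΩ_bdd : Bornology.IsBounded Ω)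
    (P : Parameters M)
    (t₀ tstar : ℝ) (ht₀ : 0 < t₀) (htstar : t₀ ≤ tstar)
    (φ0 : Fin M → L2 Ω) (θ0 : L2 Ω)
    (φ : ℝ → Fin M → L2 Ω) (θ : ℝ → L2 Ω)
    (hsol : IsSolution P tstar φ0 θ0 φ θ)
    (φC : ℝ → Fin M → H1 Ω)
    (hφC : ContDiffOn ℝ 1 φC (Set.Icc t₀ tstar))
    (hφ : ∀ t ∈ Set.Icc t₀ tstar, ∀ α, toL2 (φC t α) = φ t α) :
    MonotoneOn
      (fun t => entropy P (energyField P (θ t) (φ t)) (φC t))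
      (Set.Icc t₀ tstar) := by
  have hfin : IsFiniteMeasure (volume.restrict Ω) :=
    ⟨by simpa using hΩ_bdd.measure_lt_top⟩
  have hT : 0 < tstar := ht₀.trans_le htstar
  have hsub0 : Set.Icc t₀ tstar ⊆ Set.Icc 0 tstar := Set.Icc_subset_Icc_left ht₀.le
  have hθnn : ∀ t ∈ Set.Icc 0 tstar, 0 ≤ θ t := by
    obtain ⟨φt, θt, φH, θH, hφS, hθS, -, -, hH, hpos, -⟩ := hsol
    refine forall_mem_Icc_of_ae_mem hT hθS.1 isClosed_Ici ?_
    filter_upwards [hpos] with t ht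
    change 0 ≤ θ t
    rw [← Lp.coeFn_le]
    filter_upwards [ht, Lp.coeFn_zero ℝ 2 (volume.restrict Ω)] with x hx hx'
    rw [hx']
    exact hx.le
  have hφG : ∀ t ∈ Set.Icc 0 tstar,
      ∀ᵐ x ∂(volume.restrict Ω), (fun α => φ t α x) ∈ stdSimplex ℝ (Fin M) := by
    obtain ⟨φt, θt, φH, θH, hφS, hθS, -, -, hH, hpos, -, -, hVI, -⟩ := hsol
    refine forall_mem_Icc_of_ae_mem hT hφS.1 (isClosed_setOf_ae_mem_stdSimplex M) ?_
    filter_upwards [hH, hVI] with t ht hVIt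
    have h1 : φH t ∈ gibbsSet Ω M := mem_of_nonneg_add_chi_sub (hVIt (φH t))
    simpa only [gibbsSet, Set.mem_ofPred_eq, ht.1] using h1
  have hG : ∀ t ∈ Set.Icc t₀ tstar, φC t ∈ gibbsSet Ω M := fun t ht => by
    simpa only [gibbsSet, Set.mem_ofPred_eq, hφ t ht] using hφG t (hsub0 ht)
  have hlim : ∀ t ∈ Set.Icc t₀ tstar,
      Tendsto (fun n : ℕ => ((regEntropy P (1 / ((n : ℝ) + 1)) (θ t) (φC t) : ℝ) : EReal)) atTop
        (𝓝 (entropy P (energyField P (θ t) (φ t)) (φC t))) := fun t ht => by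
    have h1 : φ t = fun α => toL2 (φC t α) := funext fun α => (hφ t ht α).symm
    rw [entropy, show chi (gibbsSet Ω M) (φC t) = 0 from if_pos (hG t ht), sub_zero, h1]
    exact tendsto_regEntropy P (hθnn t (hsub0 ht)) (φC t)
  intro t₁ ht₁ t₂ ht₂ h12
  obtain ⟨C, hC⟩ := exists_regEntropy_le hΩ_open ht₀ hsol hφC hφ hG ht₁ ht₂ h12
  have herr : Tendsto (fun n : ℕ => ((C * (1 / ((n : ℝ) + 1)) ^ 2 * (t₂ - t₁) : ℝ) : EReal)) atTop
      (𝓝 0) := by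
    have h1 := (((tendsto_one_div_add_atTop_nhds_zero_nat (𝕜 := ℝ)).pow 2).const_mul C).mul_const
      (t₂ - t₁)
    rw [zero_pow two_ne_zero, mul_zero, zero_mul] at h1
    exact (continuous_coe_real_ereal.tendsto 0).comp h1
  -- The error tends to the finite value `0`, so extended addition is continuous here even when the
  -- entropy at `t₂` is infinite.
  have hsum := (EReal.continuousAt_add
    (p := (entropy P (energyField P (θ t₂) (φ t₂)) (φC t₂), 0)) (Or.inr EReal.zero_ne_bot)
    (Or.inr EReal.zero_ne_top)).tendsto.comp ((hlim t₂ ht₂).prodMk_nhds herr)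
  simp only [add_zero] at hsum
  refine le_of_tendsto_of_tendsto' (hlim t₁ ht₁) hsum fun n => ?_
  simp only [Function.comp_apply]
  rw [← EReal.coe_add, EReal.coe_le_coe_iff]
  exact hC _ (by positivity)

end PenroseFife

end

theorem proposition2p1 {d M : ℕ} {Ω : Set (PenroseFife.E d)}
    (hΩ_open : IsOpen Ω) (hΩ_bdd : Bornology.IsBounded Ω)
    (P : PenroseFife.Parameters M)
    (t₀ tstar : ℝ) (ht₀ : 0 < t₀) (htstar : t₀ ≤ tstar)
    (φ0 : Fin M → PenroseFife.L2 Ω) (θ0 : PenroseFife.L2 Ω)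
    (hθ0 : ∀ᵐ x ∂(volume.restrict Ω), 0 ≤ θ0 x)
    (φ : ℝ → Fin M → PenroseFife.L2 Ω) (θ : ℝ → PenroseFife.L2 Ω)
    (hsol : PenroseFife.IsSolution P tstar φ0 θ0 φ θ)
    (φC : ℝ → Fin M → PenroseFife.H1 Ω)
    (hφC : ContDiffOn ℝ 1 φC (Set.Icc t₀ tstar))
    (hφ : ∀ t ∈ Set.Icc t₀ tstar, ∀ α, PenroseFife.toL2 (φC t α) = φ t α) :
    MonotoneOn
      (fun t => PenroseFife.entropy P (PenroseFife.energyField P (θ t) (φ t)) (φC t))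
      (Set.Icc t₀ tstar) :=
  PenroseFife.monotoneOn_entropy hΩ_open hΩ_bdd P t₀ tstar ht₀ htstar φ0 θ0 φ θ hsol φC hφC hφ
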